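/- Let $\mu,\beta\in\mathbb R$ and $\sigma>0$, let $X$ and $Z$ be independent real random variables, $Z\sim N(0,1)$, where $X$ has a Lebesgue density $g$ (with values in $[0,\infty]$) that vanishes outside $(0,\infty)$, and let $Y=\mu+\beta X+\sigma\sqrt X\,Z$. Then $Y$ has the density $$f(y)=\int_0^\infty \frac{1}{\sqrt{2\pi\sigma^2x}}\exp\Big(-\frac{(y-\mu-\beta x)^2}{2\sigma^2x}\Big)\,g(x)\,dx\in[0,\infty],\qquad y\in\mathbb R,$$ which is finite for every $y\neq\mu$, and the following hold ("increasing" and "decreasing" are meant in the weak sense). (i) If $g$ is unimodal, that is, for some $m\in\mathbb R$ it is increasing on $(0,\infty)\cap(-\infty,m]$ and decreasing on $(0,\infty)\cap[m,\infty)$, then $f$ is unimodal: for some $m'\in\mathbb R$ it is increasing on $(-\infty,m']$ and decreasing on $[m',\infty)$. (ii) If $g$ is decreasing on $(0,\infty)$, or if $\beta=0$, then the only mode of $f$ is $\mu$: $f$ is increasing on $(-\infty,\mu]$ and decreasing on $[\mu,\infty)$, and $f$ has no local maximum at any point other than $\mu$. (iii) If $g$ is finite and log-concave on $(0,\infty)$,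 then $f$ is finite and log-concave on $\mathbb R$. Here $h\ge 0$ is log-concave on an interval if $h(\theta x+(1-\theta)y)\ge h(x)^\theta h(y)^{1-\theta}$ for all $x,y$ in it and all $\theta\in(0,1)$. (iv) If $g$ is positive, finite and log-convex on $(0,\infty)$ (that is, $\log g$ is convex there), then $f$ is positive, finite and log-convex on each of $(-\infty,\mu)$ and $(\mu,\infty)$. -/

import Mathlib

open Set MeasureTheory ProbabilityTheory
open scoped ENNReal

/-- `m` is a mode of `h` on the set `I`: the function `h` increases (weakly) on `I` up to `m` and
decreases (weakly) on `I` from `m` on. The point `m` may be an endpoint of `I`; for instance every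
decreasing function on `(0, ∞)` has the mode `0` there. Densities take values in `[0, ∞]`, so that
a pole at the mode is allowed. -/
def IsModeOn (I : Set ℝ) (h : ℝ → ℝ≥0∞) (m : ℝ) : Prop :=
  MonotoneOn h (I ∩ Iic m) ∧ AntitoneOn h (I ∩ Ici m)

/-- `h` is unimodal on `I`. -/
def UnimodalOn (I : Set ℝ) (h : ℝ → ℝ≥0∞) : Prop :=
  ∃ m : ℝ, IsModeOn I h m

/-- `h` is finite and log-concave on `I` (zeros are allowed). -/
def LogConcaveOn (I : Set ℝ) (h : ℝ → ℝ≥0∞) : Prop :=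
  (∀ x ∈ I, h x < ∞) ∧
    ∀ x ∈ I, ∀ y ∈ I, ∀ θ ∈ Ioo (0 : ℝ) 1,
      (h x) ^ θ * (h y) ^ (1 - θ) ≤ h (θ * x + (1 - θ) * y)

/-- `h` is positive and finite on `I`, and `log h` is convex there. -/
def LogConvexOn (I : Set ℝ) (h : ℝ → ℝ≥0∞) : Prop :=
  (∀ x ∈ I, 0 < h x ∧ h x < ∞) ∧ ConvexOn ℝ I (fun x => Real.log (h x).toReal)

/-- The density of the normal variance-mean mixture `μ + β X + σ √X Z` with mixing density `g`:
the mixture, over `x > 0` with weight `g x`, of the normal densities with mean `μ + β x` and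
variance `σ² x`. Its value at the single point `μ` may be `∞`. -/
noncomputable def mixtureDensity (μ β σ : ℝ) (g : ℝ → ℝ≥0∞) (y : ℝ) : ℝ≥0∞ :=
  ∫⁻ x in Ioi (0 : ℝ), gaussianPDF (μ + β * x) (Real.toNNReal (σ ^ 2 * x)) y * g x

open Filter Topology

/-! The affine map `y ↦ (y - μ) / σ` reduces everything to μ = 0, σ = 1. Write k_β(x, y) for the
density of N(βx, x), f for the mixture, and T(y, x) for the probability that N(-βx, x) exceeds y
(`tailProb`).

Unimodality. For y > 0 the kernel and its y-derivative are bounded in x, so f'(y) = ∫ ∂_y k_β(x, y)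
g(x) dx. Since k_{-β}(x, y) = exp(-2βy) k_β(x, y), this is -2 exp(2βy) J(y) with J(y) = ∫ ∂_x T(y,
x) g(x) dx. The superlevel sets of a unimodal g are intervals around its mode m, so the layer-cake
formula gives ∫ D' g ≥ 0 whenever D(0+) = 0, D ≤ 0 before m and D ≥ 0 after m
(`integral_deriv_mul_nonneg_of_isModeOn`). T is totally positive of order two, so for 0 < y ≤ z and
m > 0 the function D(x) = T(y, m) T(z, x) - T(z, m) T(y, x) has this sign pattern, and J(y) ≥ 0
forces J(z) ≥ 0: once f' is nonpositive on (0, ∞), it stays so. If β ≥ 0, then f increases on (-∞,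
0] because every component does; β ≤ 0 follows by reflection. For part (ii), comparison with a far
point where f' < 0 makes f' strictly negative on (0, ∞).

Log-concavity and log-convexity. The tilting g(x) ↦ exp(-β²x/2) g(x) removes the drift at the price
of a factor exp(βy). Without drift, the strong Markov property at the first passage through δ > 0
gives k(x, y + δ) = ∫ h_δ(s) k(x - s, y) ds over 0 < s < x, hence f(y + δ) = ∫ k(r, y) (∫ h_δ(s) g(r
+ s) ds) dr. The kernels k(r, y) and h_δ(s) are totally positive of order two, and log-concavity
(log-convexity) of g says that g(r + s) is reverse regular (totally positive) of order two. Two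
applications of the composition inequality pass this on to f(y + δ), which is log-concavity
(log-convexity) of f on (0, ∞). In the concave case f is also even, finite and right-continuous at
0, and decreasing on [0, ∞), so log f is concave on the whole line. -/

/-- The normal density with mean `β * x` and variance `x`, at the point `y`. -/
noncomputable def mixKernel (β x y : ℝ) : ℝ :=
  (√(2 * Real.pi * x))⁻¹ * Real.exp (-(y - β * x) ^ 2 / (2 * x))

/-- The mixture of the normal laws with mean `β * x` and variance `x`. -/
noncomputable def stdMixture (β : ℝ) (g : ℝ → ℝ≥0∞) (y : ℝ) : ℝ≥0∞ :=
  ∫⁻ x in Ioi (0 : ℝ), ENNReal.ofReal (mixKernel β x y) * g x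

/-! ### Reduction to μ = 0, σ = 1, and the law of the mixture -/

@[fun_prop]
lemma measurable_mixKernel {α : Type*} [MeasurableSpace α] {b u v : α → ℝ}
    (hb : Measurable b) (hu : Measurable u) (hv : Measurable v) :
    Measurable (fun a => mixKernel (b a) (u a) (v a)) := by
  unfold mixKernel; fun_prop

lemma mixKernel_nonneg (β x y : ℝ) : 0 ≤ mixKernel β x y := by
  unfold mixKernel; positivity

lemma mixKernel_pos (β : ℝ) {x : ℝ} (hx : 0 < x) (y : ℝ) : 0 < mixKernel β x y := by
  unfold mixKernel; positivity

lemma gaussianPDFReal_eq_mixKernel (β : ℝ) {x : ℝ} (hx : 0 ≤ x) (y : ℝ) :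
    gaussianPDFReal (β * x) (Real.toNNReal x) y = mixKernel β x y := by
  simp [gaussianPDFReal, mixKernel, Real.coe_toNNReal _ hx]

lemma gaussianPDF_eq_mixKernel (μ β : ℝ) {σ : ℝ} (hσ : 0 < σ) {x : ℝ} (hx : 0 ≤ x) (y : ℝ) :
    gaussianPDF (μ + β * x) (Real.toNNReal (σ ^ 2 * x)) y
      = ENNReal.ofReal σ⁻¹ * ENNReal.ofReal (mixKernel (β / σ) x ((y - μ) / σ)) := by
  rw [← ENNReal.ofReal_mul (by positivity), gaussianPDF, gaussianPDFReal, mixKernel,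
    Real.coe_toNNReal _ (by positivity)]
  congr 1
  rw [show 2 * Real.pi * (σ ^ 2 * x) = σ ^ 2 * (2 * Real.pi * x) by ring,
    Real.sqrt_mul (by positivity), Real.sqrt_sq hσ.le, mul_inv, mul_assoc]
  congr 3
  rcases hx.eq_or_lt with rfl | hx
  · simp
  · field_simp
    ring

lemma mixtureDensity_eq_stdMixture (μ β : ℝ) {σ : ℝ} (hσ : 0 < σ) (g : ℝ → ℝ≥0∞) (y : ℝ) :
    mixtureDensity μ β σ g y = ENNReal.ofReal σ⁻¹ * stdMixture (β / σ) g ((y - μ) / σ) := by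
  rw [mixtureDensity, stdMixture, ← lintegral_const_mul' _ _ ENNReal.ofReal_ne_top]
  refine setLIntegral_congr_fun measurableSet_Ioi fun x hx => ?_
  rw [gaussianPDF_eq_mixKernel μ β hσ (le_of_lt hx), mul_assoc]

/-- Tonelli. The right-hand side is what conditioning on X = x yields for the law of Y; the case B =
ℝ also gives the total mass of the mixture. -/
lemma lintegral_mixtureDensity (μ β σ : ℝ) {g : ℝ → ℝ≥0∞} (hg : AEMeasurable g volume)
    (B : Set ℝ) (hσ : 0 < σ) :
    ∫⁻ y in B, mixtureDensity μ β σ g y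
      = ∫⁻ x in Ioi (0 : ℝ), g x * gaussianReal (μ + β * x) (Real.toNNReal (σ ^ 2 * x)) B := by
  unfold mixtureDensity
  rw [lintegral_lintegral_swap]
  · refine setLIntegral_congr_fun measurableSet_Ioi fun x (hx : 0 < x) => ?_
    have h0 : Real.toNNReal (σ ^ 2 * x) ≠ 0 := by simp; positivity
    rw [lintegral_mul_const _ (measurable_gaussianPDF _ _), mul_comm, gaussianReal_apply _ h0]
  · refine AEMeasurable.mul ?_ ?_
    · refine Measurable.aemeasurable ?_
      exact measurable_uncurry_gaussianPDF.comp (f := fun p : ℝ × ℝ =>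
        (μ + β * p.2, Real.toNNReal (σ ^ 2 * p.2), p.1)) (by fun_prop)
    · exact hg.restrict.comp_snd

lemma withDensity_restrict_of_support {g : ℝ → ℝ≥0∞} (hg_supp : ∀ x ≤ 0, g x = 0) :
    (volume.restrict (Ioi (0 : ℝ))).withDensity g = volume.withDensity g := by
  rw [← restrict_withDensity measurableSet_Ioi]
  refine Measure.restrict_eq_self_of_ae_mem ?_
  rw [ae_iff]
  have hs : MeasurableSet {a : ℝ | a ∉ Ioi (0 : ℝ)} := measurableSet_Ioi.compl
  rw [withDensity_apply _ hs, ← lintegral_zero]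
  refine setLIntegral_congr_fun hs fun x hx => ?_
  exact hg_supp x (by simpa using hx)

lemma gaussianReal_zero_one_preimage (a c : ℝ) {B : Set ℝ} (hB : MeasurableSet B) {v : ℝ}
    (hv : c ^ 2 = v) :
    gaussianReal 0 1 ((fun z => a + c * z) ⁻¹' B) = gaussianReal a (Real.toNNReal v) B := by
  have h1 : (gaussianReal 0 1).map (fun z => a + c * z) = gaussianReal a (Real.toNNReal v) := by
    have := gaussianReal_map_const_mul (μ := 0) (v := 1) c
    have h2 : (fun z => a + c * z) = (fun z => a + z) ∘ (fun z => c * z) := rfl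
    rw [h2, ← Measure.map_map (by fun_prop) (by fun_prop), this, gaussianReal_map_const_add]
    congr 1
    · simp
    · ext; simp [← hv, Real.coe_toNNReal _ (sq_nonneg c)]
  rw [← h1, Measure.map_apply (by fun_prop) hB]

theorem hasLaw_mixture {Ω : Type*} [MeasurableSpace Ω] (P : Measure Ω) [IsProbabilityMeasure P]
    (X Z : Ω → ℝ) (μ β σ : ℝ) (hσ : 0 < σ)
    (g : ℝ → ℝ≥0∞) (hg : AEMeasurable g volume) (hg_supp : ∀ x ≤ 0, g x = 0)
    (hX : HasLaw X (volume.withDensity g) P) (hZ : HasLaw Z (gaussianReal 0 1) P)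
    (hXZ : IndepFun X Z P) :
    HasLaw (fun ω => μ + β * X ω + σ * Real.sqrt (X ω) * Z ω)
        (volume.withDensity (mixtureDensity μ β σ g)) P := by
  have hXm := hX.aemeasurable
  have hZm := hZ.aemeasurable
  refine ⟨by fun_prop, ?_⟩
  have hprod := (indepFun_iff_map_prod_eq_prod_map_map hXm hZm).1 hXZ
  rw [hX.map_eq, hZ.map_eq] at hprod
  have hsf : SFinite (volume.withDensity g) := by
    rw [← hX.map_eq]; infer_instance
  let T : ℝ × ℝ → ℝ := fun p => μ + β * p.1 + σ * √p.1 * p.2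
  have hT : Measurable T := by fun_prop
  have hcomp : (fun ω => μ + β * X ω + σ * √(X ω) * Z ω) = T ∘ (fun ω => (X ω, Z ω)) := rfl
  rw [hcomp, ← AEMeasurable.map_map_of_aemeasurable hT.aemeasurable (hXm.prodMk hZm), hprod]
  ext B hB
  rw [withDensity_apply _ hB, lintegral_mixtureDensity μ β σ hg B hσ, Measure.map_apply hT hB,
    Measure.prod_apply (hT hB), ← withDensity_restrict_of_support hg_supp,
    lintegral_withDensity_eq_lintegral_mul₀ hg.restrict
      (measurable_measure_prodMk_left (hT hB)).aemeasurable]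
  refine setLIntegral_congr_fun measurableSet_Ioi fun x (hx : 0 < x) => ?_
  rw [Pi.mul_apply, ← gaussianReal_zero_one_preimage (μ + β * x) (σ * √x) hB
    (by rw [mul_pow, Real.sq_sqrt hx.le])]
  rfl

lemma lintegral_density_eq_one {Ω : Type*} [MeasurableSpace Ω] {P : Measure Ω}
    [IsProbabilityMeasure P] {X : Ω → ℝ} {g : ℝ → ℝ≥0∞} (hg_supp : ∀ x ≤ 0, g x = 0)
    (hX : HasLaw X (volume.withDensity g) P) : ∫⁻ x in Ioi (0 : ℝ), g x = 1 := by
  have h1 : (volume.withDensity g) univ = 1 := by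
    rw [← hX.map_eq, Measure.map_apply_of_aemeasurable hX.aemeasurable MeasurableSet.univ]
    simp
  rw [← withDensity_restrict_of_support hg_supp] at h1
  simpa using h1

lemma lintegral_stdMixture (β : ℝ) {g : ℝ → ℝ≥0∞} (hg : AEMeasurable g volume) :
    ∫⁻ y, stdMixture β g y = ∫⁻ x in Ioi (0 : ℝ), g x := by
  have h := lintegral_mixtureDensity 0 β 1 hg univ one_pos
  simp only [mixtureDensity_eq_stdMixture 0 β one_pos g] at h
  simpa using h

/-! ### Tilting, monotonicity, and one-sided continuity at the origin -/

/-- Expanding the square in the exponent, the drift contributes a function of y times a function of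
x; the latter can be absorbed into the mixing density. -/
lemma mixKernel_eq_exp_mul (β : ℝ) {x : ℝ} (hx : 0 < x) (y : ℝ) :
    mixKernel β x y
      = Real.exp (β * y) * (Real.exp (-β ^ 2 / 2 * x) * mixKernel 0 x y) := by
  unfold mixKernel
  rw [mul_left_comm (Real.exp (-β ^ 2 / 2 * x)), mul_left_comm (Real.exp (β * y)), ← Real.exp_add,
    ← Real.exp_add]
  congr 2
  field_simp
  ring

lemma mixKernel_neg (β x y : ℝ) : mixKernel β x (-y) = mixKernel (-β) x y := by
  unfold mixKernel; congr 3; ring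

lemma mixKernel_le_mixKernel {β x y z : ℝ} (hx : 0 < x)
    (h : (z - β * x) ^ 2 ≤ (y - β * x) ^ 2) : mixKernel β x y ≤ mixKernel β x z := by
  unfold mixKernel
  gcongr

lemma stdMixture_neg (β : ℝ) (g : ℝ → ℝ≥0∞) (y : ℝ) :
    stdMixture β g (-y) = stdMixture (-β) g y := by
  simp [stdMixture, mixKernel_neg]

/-- Exponential tilting of a mixing density, which removes the drift from a mixture. -/
noncomputable def tilt (β : ℝ) (g : ℝ → ℝ≥0∞) (x : ℝ) : ℝ≥0∞ :=
  ENNReal.ofReal (Real.exp (-β ^ 2 / 2 * x)) * g x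

lemma aemeasurable_tilt (β : ℝ) {g : ℝ → ℝ≥0∞} (hg : AEMeasurable g volume) :
    AEMeasurable (tilt β g) volume := by
  unfold tilt; fun_prop

lemma stdMixture_eq_exp_mul (β : ℝ) (g : ℝ → ℝ≥0∞) (y : ℝ) :
    stdMixture β g y = ENNReal.ofReal (Real.exp (β * y)) * stdMixture 0 (tilt β g) y := by
  rw [stdMixture, stdMixture, ← lintegral_const_mul' _ _ ENNReal.ofReal_ne_top]
  refine setLIntegral_congr_fun measurableSet_Ioi fun x (hx : 0 < x) => ?_
  simp only [tilt]
  rw [mixKernel_eq_exp_mul β hx, ENNReal.ofReal_mul (by positivity),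
    ENNReal.ofReal_mul (by positivity)]
  ring

lemma stdMixture_le_of_sq_le {β : ℝ} (g : ℝ → ℝ≥0∞) {y z : ℝ}
    (h : ∀ x > 0, (z - β * x) ^ 2 ≤ (y - β * x) ^ 2) : stdMixture β g y ≤ stdMixture β g z := by
  refine setLIntegral_mono' measurableSet_Ioi fun x hx => ?_
  gcongr
  exact mixKernel_le_mixKernel hx (h x hx)

lemma stdMixture_zero_antitoneOn (g : ℝ → ℝ≥0∞) : AntitoneOn (stdMixture 0 g) (Ici 0) := by
  intro y hy z hz hyz
  refine stdMixture_le_of_sq_le g fun x hx => ?_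
  simp only [mem_Ici] at hy
  simp only [zero_mul, sub_zero]
  gcongr

/-- All component means βx are nonnegative, so every component increases on (-∞, 0]. -/
lemma stdMixture_monotoneOn_Iic {β : ℝ} (hβ : 0 ≤ β) (g : ℝ → ℝ≥0∞) :
    MonotoneOn (stdMixture β g) (Iic 0) := by
  intro y hy z hz hyz
  refine stdMixture_le_of_sq_le g fun x hx => ?_
  simp only [mem_Iic] at hz
  have : 0 ≤ β * x := by positivity
  nlinarith

/-- The value at 0 may be ∞, so domination is not available. Monotone convergence along 1/(n+1)
gives the limit on a sequence, and monotonicity in y carries it to the whole right neighbourhood. -/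
lemma tendsto_stdMixture_zero_nhdsGT {g : ℝ → ℝ≥0∞} (hg : AEMeasurable g volume) :
    Tendsto (stdMixture 0 g) (𝓝[>] 0) (𝓝 (stdMixture 0 g 0)) := by
  have hseq : Tendsto (fun n : ℕ => stdMixture 0 g (1 / ((n : ℝ) + 1))) atTop
      (𝓝 (stdMixture 0 g 0)) := by
    refine lintegral_tendsto_of_tendsto_of_monotone (fun n => ?_) ?_ ?_
    · exact ((measurable_mixKernel measurable_const measurable_id
        measurable_const).ennreal_ofReal.aemeasurable.mul hg).restrict
    · refine (ae_restrict_iff' measurableSet_Ioi).2 (ae_of_all _ fun x hx n k hnk => ?_)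
      simp only
      gcongr ENNReal.ofReal ?_ * _
      refine mixKernel_le_mixKernel hx ?_
      have : 1 / ((k : ℝ) + 1) ≤ 1 / ((n : ℝ) + 1) := by gcongr
      simp only [zero_mul, sub_zero]
      gcongr
    · refine (ae_restrict_iff' measurableSet_Ioi).2 (ae_of_all _ fun x (hx : 0 < x) => ?_)
      refine ENNReal.Tendsto.mul_const ?_ ?_
      · refine ENNReal.tendsto_ofReal ?_
        have hc : Continuous (fun y => mixKernel 0 x y) := by unfold mixKernel; fun_prop
        exact (hc.tendsto 0).comp tendsto_one_div_add_atTop_nhds_zero_nat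
      · left
        simpa using mixKernel_pos 0 hx 0
  refine tendsto_order.2 ⟨fun a ha => ?_, fun a ha => ?_⟩
  · obtain ⟨n, hn⟩ := (hseq.eventually (lt_mem_nhds ha)).exists
    have hp : (0 : ℝ) < 1 / ((n : ℝ) + 1) := by positivity
    filter_upwards [Ioo_mem_nhdsGT hp] with y hy
    exact hn.trans_le (stdMixture_zero_antitoneOn g hy.1.le hp.le hy.2.le)
  · filter_upwards [self_mem_nhdsWithin] with y hy
    have hy' : (0 : ℝ) ≤ y := le_of_lt hy
    exact (stdMixture_zero_antitoneOn g self_mem_Ici hy' hy').trans_lt ha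

lemma tendsto_stdMixture_nhdsGT (β : ℝ) {g : ℝ → ℝ≥0∞} (hg : AEMeasurable g volume) :
    Tendsto (stdMixture β g) (𝓝[>] 0) (𝓝 (stdMixture β g 0)) := by
  have h := tendsto_stdMixture_zero_nhdsGT (aemeasurable_tilt β hg)
  have h1 : Tendsto (fun y : ℝ => ENNReal.ofReal (Real.exp (β * y))) (𝓝[>] 0)
      (𝓝 (ENNReal.ofReal (Real.exp (β * 0)))) := by
    refine ENNReal.tendsto_ofReal ?_
    have : Continuous fun y : ℝ => Real.exp (β * y) := by fun_prop
    exact (this.tendsto 0).mono_left nhdsWithin_le_nhds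
  rw [stdMixture_eq_exp_mul β g 0]
  refine (ENNReal.Tendsto.mul h1 (Or.inl (by simp)) h (Or.inr ENNReal.ofReal_ne_top)).congr ?_
  intro y
  rw [stdMixture_eq_exp_mul β g y]

/-! ### Kernel bounds and differentiation under the integral -/

lemma inv_sqrt_le (x : ℝ) (hx : 0 < x) : (√(2 * Real.pi * x))⁻¹ ≤ 1 + 1 / x := by
  have hpi := Real.pi_gt_three
  rcases le_total 1 (2 * Real.pi * x) with h | h
  · have : 1 ≤ √(2 * Real.pi * x) := Real.one_le_sqrt.2 h
    have h2 := inv_le_one_of_one_le₀ this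
    have : 0 < 1 / x := by positivity
    linarith
  · have h1 : x ≤ √(2 * Real.pi * x) := by
      refine Real.le_sqrt_of_sq_le ?_
      nlinarith
    have h2 : (√(2 * Real.pi * x))⁻¹ ≤ x⁻¹ := inv_anti₀ hx h1
    rw [one_div]; linarith

lemma mul_exp_neg_le {c t : ℝ} (hc : 0 < c) (ht : 0 ≤ t) :
    t * Real.exp (-(c * t)) ≤ 1 / c ∧ t ^ 2 * Real.exp (-(c * t)) ≤ 2 / c ^ 2 := by
  have hct : 0 ≤ c * t := by positivity
  have h1 := Real.pow_div_factorial_le_exp (c * t) hct 1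
  have h2 := Real.pow_div_factorial_le_exp (c * t) hct 2
  norm_num [Nat.factorial] at h1 h2
  rw [Real.exp_neg]
  have he := Real.exp_pos (c * t)
  constructor
  · rw [← div_eq_mul_inv, div_le_div_iff₀ he hc]; linarith
  · rw [← div_eq_mul_inv, div_le_div_iff₀ he (by positivity)]; nlinarith

/-- Away from y = 0 the factor exp(-y²/(2x)) beats every negative power of x at 0. The bounds are
uniform in x and locally uniform in y, so integrability of g alone permits differentiation under the
integral. -/
lemma mixKernel_bounds (β : ℝ) {y₀ : ℝ} (hy₀ : 0 < y₀) :
    ∃ C, ∀ y ∈ Ioo (y₀ / 2) (2 * y₀), ∀ x > 0,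
      mixKernel β x y ≤ C ∧ |(β - y / x) * mixKernel β x y| ≤ C := by
  -- c = (y₀/2)²/2 comes from the lower end of the range of y. With t = 1/x, everything becomes a
  -- polynomial of degree at most two in t times exp(-ct).
  set c := y₀ ^ 2 / 8 with hc
  have hc0 : 0 < c := by positivity
  set E := Real.exp (|β| * (2 * y₀)) with hE
  have hE0 : 0 < E := Real.exp_pos _
  refine ⟨max (E * (1 + 1 / c)) (E * (|β| + (|β| + 2 * y₀) * (1 / c) + 2 * y₀ * (2 / c ^ 2))), ?_⟩
  intro y hy x hx
  obtain ⟨hy1, hy2⟩ := hy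
  have ht : 0 < 1 / x := by positivity
  set t := 1 / x with htx
  set e := Real.exp (-(c * t)) with he
  have he0 : 0 < e := Real.exp_pos _
  have he1 : e ≤ 1 := by
    rw [he, Real.exp_le_one_iff]; have := mul_pos hc0 ht; linarith
  have hK : mixKernel β x y ≤ E * ((1 + t) * e) := by
    rw [mixKernel_eq_exp_mul β hx]
    have h1 : Real.exp (β * y) ≤ E := by
      rw [hE]
      refine Real.exp_le_exp.2 ?_
      calc β * y ≤ |β| * y := mul_le_mul_of_nonneg_right (le_abs_self β) (by linarith)
        _ ≤ _ := by gcongr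
    have h2 : Real.exp (-β ^ 2 / 2 * x) ≤ 1 := by
      rw [Real.exp_le_one_iff]; nlinarith [mul_nonneg (sq_nonneg β) hx.le]
    have h3 : mixKernel 0 x y ≤ (1 + t) * e := by
      unfold mixKernel
      gcongr
      · exact inv_sqrt_le x hx
      · rw [he, htx, hc, neg_div, Real.exp_le_exp, neg_le_neg_iff, zero_mul, sub_zero]
        rw [show y₀ ^ 2 / 8 * (1 / x) = (y₀ / 2) ^ 2 / (2 * x) by field_simp; norm_num]
        gcongr
    calc _ ≤ E * (1 * ((1 + t) * e)) := by
          gcongr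
          exact mul_nonneg (Real.exp_pos _).le (mixKernel_nonneg _ _ _)
          exact mixKernel_nonneg _ _ _
      _ = _ := by ring
  obtain ⟨b1, b2⟩ := mul_exp_neg_le hc0 ht.le
  rw [← he] at b1 b2
  refine ⟨le_max_of_le_left (hK.trans ?_), le_max_of_le_right ?_⟩
  · gcongr; linarith
  · rw [abs_mul, abs_of_nonneg (mixKernel_nonneg β x y)]
    have h4 : |β - y / x| ≤ |β| + 2 * y₀ * t := by
      calc |β - y / x| ≤ |β| + |y / x| := abs_sub _ _
        _ ≤ _ := by
          gcongr
          rw [abs_of_pos (by have : 0 < y := by linarith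
                             positivity), htx, div_eq_mul_one_div]
          gcongr
    calc _ ≤ (|β| + 2 * y₀ * t) * (E * ((1 + t) * e)) := by
          gcongr
          exact mixKernel_nonneg _ _ _
      _ = E * (|β| * e + (|β| + 2 * y₀) * (t * e) + 2 * y₀ * (t ^ 2 * e)) := by ring
      _ ≤ _ := by
        gcongr
        calc |β| * e ≤ |β| * 1 := by gcongr
          _ = |β| := mul_one _

section

variable {g : ℝ → ℝ≥0∞}

lemma integrableOn_toReal (hg : AEMeasurable g volume) (hfin : ∫⁻ x in Ioi (0 : ℝ), g x ≠ ∞) :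
    IntegrableOn (fun x => (g x).toReal) (Ioi 0) :=
  integrable_toReal_of_lintegral_ne_top hg.restrict hfin

lemma stdMixture_lt_top (β : ℝ) (hfin : ∫⁻ x in Ioi (0 : ℝ), g x ≠ ∞) {y : ℝ} (hy : 0 < y) :
    stdMixture β g y < ∞ := by
  obtain ⟨C, hC⟩ := mixKernel_bounds β hy
  calc stdMixture β g y ≤ ∫⁻ x in Ioi (0 : ℝ), ENNReal.ofReal C * g x := by
        refine setLIntegral_mono' measurableSet_Ioi fun x hx => ?_
        gcongr
        exact (hC y ⟨by linarith, by linarith⟩ x hx).1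
    _ = ENNReal.ofReal C * ∫⁻ x in Ioi (0 : ℝ), g x :=
        lintegral_const_mul' _ _ ENNReal.ofReal_ne_top
    _ < ∞ := ENNReal.mul_lt_top ENNReal.ofReal_lt_top (lt_top_iff_ne_top.2 hfin)

lemma stdMixture_lt_top_of_ne (β : ℝ) (hfin : ∫⁻ x in Ioi (0 : ℝ), g x ≠ ∞) {y : ℝ}
    (hy : y ≠ 0) : stdMixture β g y < ∞ := by
  rcases hy.lt_or_gt with h | h
  · rw [← neg_neg y, stdMixture_neg]
    exact stdMixture_lt_top _ hfin (by linarith)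
  · exact stdMixture_lt_top _ hfin h

lemma stdMixture_pos (β : ℝ) (hg : AEMeasurable g volume)
    (hpos : ∫⁻ x in Ioi (0 : ℝ), g x ≠ 0) (y : ℝ) : 0 < stdMixture β g y := by
  rw [pos_iff_ne_zero]
  intro h
  apply hpos
  have hm : AEMeasurable (fun x => ENNReal.ofReal (mixKernel β x y) * g x)
      (volume.restrict (Ioi 0)) := by
    have := hg.restrict (s := Ioi 0)
    fun_prop
  rw [stdMixture, lintegral_eq_zero_iff' hm] at h
  rw [lintegral_eq_zero_iff' hg.restrict]
  filter_upwards [h, ae_restrict_mem measurableSet_Ioi] with x hx hx0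
  have := mixKernel_pos β hx0 y
  simpa [this.not_ge] using hx

lemma toReal_stdMixture (β : ℝ) (hg : AEMeasurable g volume)
    (hfin : ∫⁻ x in Ioi (0 : ℝ), g x ≠ ∞) (y : ℝ) :
    (stdMixture β g y).toReal = ∫ x in Ioi (0 : ℝ), mixKernel β x y * (g x).toReal := by
  have hg' := hg.restrict (s := Ioi 0)
  rw [stdMixture, ← integral_toReal (by fun_prop)]
  · simp [ENNReal.toReal_ofReal (mixKernel_nonneg _ _ _)]
  · filter_upwards [ae_lt_top' hg' hfin] with x hx
    exact ENNReal.mul_lt_top ENNReal.ofReal_lt_top hx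

/-- The derivative of the density of the mixture on the positive half-line. -/
noncomputable def stdMixtureDeriv (β : ℝ) (g : ℝ → ℝ≥0∞) (y : ℝ) : ℝ :=
  ∫ x in Ioi (0 : ℝ), (β - y / x) * mixKernel β x y * (g x).toReal

lemma hasDerivAt_mixKernel (β : ℝ) {x : ℝ} (hx : 0 < x) (y : ℝ) :
    HasDerivAt (mixKernel β x) ((β - y / x) * mixKernel β x y) y := by
  unfold mixKernel
  have h1 : HasDerivAt (fun y => -(y - β * x) ^ 2 / (2 * x)) (β - y / x) y := by
    have := ((((hasDerivAt_id y).sub_const (β * x)).pow 2).neg).div_const (2 * x)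
    refine this.congr_deriv ?_
    simp
    field_simp
    ring
  exact (h1.exp.const_mul _).congr_deriv (by ring)

lemma integrableOn_deriv_mixKernel_mul (β : ℝ) (hg : AEMeasurable g volume)
    (hfin : ∫⁻ x in Ioi (0 : ℝ), g x ≠ ∞) {y : ℝ} (hy : 0 < y) :
    IntegrableOn (fun x => (β - y / x) * mixKernel β x y * (g x).toReal) (Ioi 0) := by
  obtain ⟨C, hC⟩ := mixKernel_bounds β hy
  refine (integrableOn_toReal hg hfin).bdd_mul (c := C) ?_ ?_
  · refine Measurable.aestronglyMeasurable ?_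
    fun_prop
  · filter_upwards [ae_restrict_mem measurableSet_Ioi] with x hx
    exact (hC y ⟨by linarith, by linarith⟩ x hx).2

lemma hasDerivAt_stdMixture (β : ℝ) (hg : AEMeasurable g volume)
    (hfin : ∫⁻ x in Ioi (0 : ℝ), g x ≠ ∞) {y : ℝ} (hy : 0 < y) :
    HasDerivAt (fun y => (stdMixture β g y).toReal) (stdMixtureDeriv β g y) y := by
  simp only [toReal_stdMixture β hg hfin]
  obtain ⟨C, hC⟩ := mixKernel_bounds β hy
  have hG := integrableOn_toReal hg hfin
  have hGm := hG.aestronglyMeasurable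
  have hyI : y ∈ Ioo (y / 2) (2 * y) := ⟨by linarith, by linarith⟩
  refine (hasDerivAt_integral_of_dominated_loc_of_deriv_le (s := Ioo (y / 2) (2 * y))
    (bound := fun x => C * (g x).toReal)
    (F' := fun y x => (β - y / x) * mixKernel β x y * (g x).toReal)
    (isOpen_Ioo.mem_nhds hyI) (Eventually.of_forall fun z => ?_) ?_ ?_ ?_ (hG.const_mul C) ?_).2
  · refine AEStronglyMeasurable.mul (Measurable.aestronglyMeasurable ?_) hGm
    fun_prop
  · refine hG.bdd_mul (c := C) (Measurable.aestronglyMeasurable ?_) ?_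
    · fun_prop
    · filter_upwards [ae_restrict_mem measurableSet_Ioi] with x hx
      rw [Real.norm_of_nonneg (mixKernel_nonneg _ _ _)]
      exact (hC y hyI x hx).1
  · exact (integrableOn_deriv_mixKernel_mul β hg hfin hy).aestronglyMeasurable
  · filter_upwards [ae_restrict_mem measurableSet_Ioi] with x hx z hz
    rw [norm_mul, Real.norm_of_nonneg (ENNReal.toReal_nonneg)]
    gcongr
    exact (hC z hz x hx).2
  · filter_upwards [ae_restrict_mem measurableSet_Ioi] with x hx z hz
    exact (hasDerivAt_mixKernel β hx z).mul_const _

/-- A positive function that increases on a half-line has infinite integral, while the mixture has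
the same finite mass as g. -/
lemma not_monotoneOn_stdMixture_Ici (β : ℝ) (hg : AEMeasurable g volume)
    (hfin : ∫⁻ x in Ioi (0 : ℝ), g x ≠ ∞) (hpos : ∫⁻ x in Ioi (0 : ℝ), g x ≠ 0) (a : ℝ) :
    ¬ MonotoneOn (stdMixture β g) (Ici a) := by
  intro h
  apply hfin
  rw [← lintegral_stdMixture β hg, eq_top_iff]
  calc ∞ = ∫⁻ _ in Ici a, stdMixture β g a := by
        simp [(stdMixture_pos β hg hpos a).ne']
    _ ≤ ∫⁻ y in Ici a, stdMixture β g y :=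
        setLIntegral_mono' measurableSet_Ici fun y hy => h self_mem_Ici hy hy
    _ ≤ _ := setLIntegral_le_lintegral _ _

/-- Monotonicity of the mixture on a set of positive reals, from the sign of its derivative. -/
lemma stdMixture_monotoneOn (β : ℝ) (hg : AEMeasurable g volume)
    (hfin : ∫⁻ x in Ioi (0 : ℝ), g x ≠ ∞) {D : Set ℝ} (hD : Convex ℝ D) (hD0 : D ⊆ Ioi 0)
    (h : ∀ y ∈ interior D, 0 ≤ stdMixtureDeriv β g y) : MonotoneOn (stdMixture β g) D := by
  have hd := fun y (hy : y ∈ D) => hasDerivAt_stdMixture β hg hfin (hD0 hy)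
  have hm := monotoneOn_of_deriv_nonneg hD
    (fun y hy => (hd y hy).continuousAt.continuousWithinAt)
    (fun y hy => (hd y (interior_subset hy)).differentiableAt.differentiableWithinAt)
    (fun y hy => by rw [(hd y (interior_subset hy)).deriv]; exact h y hy)
  intro y hy z hz hyz
  exact (ENNReal.toReal_le_toReal (stdMixture_lt_top β hfin (hD0 hy)).ne
    (stdMixture_lt_top β hfin (hD0 hz)).ne).1 (hm hy hz hyz)

lemma stdMixture_antitoneOn (β : ℝ) (hg : AEMeasurable g volume)
    (hfin : ∫⁻ x in Ioi (0 : ℝ), g x ≠ ∞) {D : Set ℝ} (hD : Convex ℝ D) (hD0 : D ⊆ Ioi 0)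
    (h : ∀ y ∈ interior D, stdMixtureDeriv β g y ≤ 0) : AntitoneOn (stdMixture β g) D := by
  have hd := fun y (hy : y ∈ D) => hasDerivAt_stdMixture β hg hfin (hD0 hy)
  have hm := antitoneOn_of_deriv_nonpos hD
    (fun y hy => (hd y hy).continuousAt.continuousWithinAt)
    (fun y hy => (hd y (interior_subset hy)).differentiableAt.differentiableWithinAt)
    (fun y hy => by rw [(hd y (interior_subset hy)).deriv]; exact h y hy)
  intro y hy z hz hyz
  exact (ENNReal.toReal_le_toReal (stdMixture_lt_top β hfin (hD0 hz)).ne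
    (stdMixture_lt_top β hfin (hD0 hy)).ne).1 (hm hy hz hyz)

end

/-! ### The layer-cake sign argument -/

section LayerCake

variable {g : ℝ → ℝ≥0∞} {m : ℝ}

lemma IsModeOn.ordConnected_superlevel (h : IsModeOn (Ioi 0) g m) (s : ℝ≥0∞) :
    OrdConnected {x | 0 < x ∧ s < g x} := by
  refine ⟨fun x hx z hz y hy => ⟨hx.1.trans_le hy.1, ?_⟩⟩
  have hy0 : 0 < y := hx.1.trans_le hy.1
  rcases le_total y m with hym | hym
  · exact hx.2.trans_le (h.1 ⟨hx.1, hy.1.trans hym⟩ ⟨hy0, hym⟩ hy.1)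
  · exact hz.2.trans_le (h.2 ⟨hy0, hym⟩ ⟨hz.1, hym.trans hy.2⟩ hy.2)

lemma IsModeOn.mode_mem_superlevel (h : IsModeOn (Ioi 0) g m) (hm : 0 < m) {s : ℝ≥0∞} {x : ℝ}
    (hx : 0 < x) (hs : s < g x) : s < g m := by
  rcases le_total x m with hxm | hxm
  · exact hs.trans_le (h.1 ⟨hx, hxm⟩ ⟨hm, self_mem_Iic⟩ hxm)
  · exact hs.trans_le (h.2 ⟨hm, self_mem_Ici⟩ ⟨hx, hxm⟩ hxm)

/-- An unbounded superlevel set, being order connected, would contain a half-line, and g would have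
infinite mass. -/
lemma bddAbove_superlevel (hfin : ∫⁻ x in Ioi (0 : ℝ), g x ≠ ∞) (h : IsModeOn (Ioi 0) g m) {s : ℝ≥0∞} (hs : s ≠ 0) :
    BddAbove {x | 0 < x ∧ s < g x} := by
  by_contra hb
  rw [not_bddAbove_iff] at hb
  obtain ⟨a, ha, -⟩ := hb 0
  have hsub : Ici a ⊆ {x | 0 < x ∧ s < g x} := by
    intro x hx
    obtain ⟨z, hz, hxz⟩ := hb x
    exact (h.ordConnected_superlevel s).out ha hz ⟨hx, hxz.le⟩
  apply hfin
  rw [eq_top_iff]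
  calc ∞ = ∫⁻ _ in Ici a, s := by simp [hs]
    _ ≤ ∫⁻ x in Ici a, g x := setLIntegral_mono' measurableSet_Ici fun x hx => (hsub hx).2.le
    _ ≤ _ := lintegral_mono_set fun x hx => (hsub hx).1

variable {D d : ℝ → ℝ}

/-- Up to its endpoints a < b the superlevel set is an interval, over which d integrates to D(b) -
D(a+). If m > 0 then m belongs to the set, so a ≤ m ≤ b and the signs of D apply; if m ≤ 0 then a =
0, where D tends to 0. -/
lemma setIntegral_superlevel_nonneg (hfin : ∫⁻ x in Ioi (0 : ℝ), g x ≠ ∞) (h : IsModeOn (Ioi 0) g m)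
    (hD : ∀ x > 0, HasDerivAt D (d x) x) (h0 : Tendsto D (𝓝[>] 0) (𝓝 0))
    (hdm : Measurable d) {C : ℝ} (hC : ∀ x > 0, |d x| ≤ C)
    (hle : ∀ x, 0 < x → x ≤ m → D x ≤ 0) (hge : ∀ x, 0 < x → m ≤ x → 0 ≤ D x)
    {s : ℝ≥0∞} (hs : s ≠ 0) :
    0 ≤ ∫ x in {x | 0 < x ∧ s < g x}, d x := by
  set T := {x | 0 < x ∧ s < g x} with hT
  rcases T.eq_empty_or_nonempty with he | ⟨z, hz⟩
  · simp [he]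
  have hoc : OrdConnected T := h.ordConnected_superlevel s
  have hba : BddAbove T := bddAbove_superlevel hfin h hs
  have hbb : BddBelow T := ⟨0, fun x hx => hx.1.le⟩
  set a := sInf T
  set b := sSup T
  have hsub1 : Ioo a b ⊆ T := by
    intro x hx
    obtain ⟨u, hu, hux⟩ := exists_lt_of_csInf_lt ⟨z, hz⟩ hx.1
    obtain ⟨v, hv, hxv⟩ := exists_lt_of_lt_csSup ⟨z, hz⟩ hx.2
    exact hoc.out hu hv ⟨hux.le, hxv.le⟩
  have hsub2 : T ⊆ Icc a b := fun x hx => ⟨csInf_le hbb hx, le_csSup hba hx⟩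
  have ha0 : 0 ≤ a := le_csInf ⟨z, hz⟩ fun x hx => hx.1.le
  have hzb : z ≤ b := le_csSup hba hz
  have hb0 : 0 < b := hz.1.trans_le hzb
  have hab : a ≤ b := (csInf_le hbb hz).trans hzb
  have hTae : T =ᵐ[volume] Ioc a b := by
    have h1 : Ioo a b =ᵐ[volume] Ioc a b := Ioo_ae_eq_Ioc
    have h2 : Icc a b =ᵐ[volume] Ioc a b := Ioc_ae_eq_Icc.symm
    exact (hsub2.eventuallyLE.trans h2.le).antisymm (h1.symm.le.trans hsub1.eventuallyLE)
  rw [setIntegral_congr_set hTae, ← intervalIntegral.integral_of_le hab]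
  rcases hab.eq_or_lt with hab | hab
  · simp [hab]
  have hDb : 0 ≤ D b := by
    refine hge b hb0 ?_
    rcases le_or_gt m 0 with hm | hm
    · exact hm.trans hb0.le
    · exact le_csSup hba ⟨hm, h.mode_mem_superlevel hm hz.1 hz.2⟩
  -- A right limit replaces D(a), because nothing is assumed about the value of D at 0.
  obtain ⟨l, hl, hl0⟩ : ∃ l, Tendsto D (𝓝[>] a) (𝓝 l) ∧ l ≤ 0 := by
    rcases ha0.eq_or_lt with ha | ha
    · exact ⟨0, ha ▸ h0, le_rfl⟩
    · refine ⟨D a, (hD a ha).continuousAt.tendsto.mono_left nhdsWithin_le_nhds, hle a ha ?_⟩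
      rcases le_or_gt m 0 with hm | hm
      · exfalso
        -- With m ≤ 0, g decreases on all of (0, ∞), so the superlevel set reaches down to 0 and a >
        -- 0 is impossible.
        have h1 : a / 2 ∈ T := by
          refine ⟨by linarith, hz.2.trans_le (h.2 ⟨by simpa using ha, ?_⟩ ⟨hz.1, ?_⟩ ?_)⟩
          · simp only [mem_Ici]; linarith
          · exact hm.trans hz.1.le
          · linarith [csInf_le hbb hz]
        have : a ≤ a / 2 := csInf_le hbb h1
        linarith
      · exact csInf_le hbb ⟨hm, h.mode_mem_superlevel hm hz.1 hz.2⟩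
  rw [intervalIntegral.integral_eq_sub_of_hasDerivAt_of_tendsto hab
    (fun x hx => hD x (ha0.trans_lt hx.1)) ?_ hl
    ((hD b hb0).continuousAt.tendsto.mono_left nhdsWithin_le_nhds)]
  · linarith
  · rw [intervalIntegrable_iff_integrableOn_Ioc_of_le hab.le]
    refine Measure.integrableOn_of_bounded (M := C) (by simp) hdm.aestronglyMeasurable ?_
    filter_upwards [ae_restrict_mem measurableSet_Ioc] with x hx
    exact hC x (ha0.trans_lt hx.1)

lemma integrableOn_Ioi_indicator_lt (c r : ℝ) :
    IntegrableOn (fun t => (Iio r).indicator (fun _ => c) t) (Ioi 0) := by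
  rw [← integrable_indicator_iff measurableSet_Ioi, indicator_indicator,
    integrable_indicator_iff (measurableSet_Ioi.inter measurableSet_Iio), Ioi_inter_Iio]
  simp [integrableOn_const_iff]

lemma integral_Ioi_indicator_lt (c : ℝ) {r : ℝ} (hr : 0 ≤ r) :
    ∫ t in Ioi (0 : ℝ), (Iio r).indicator (fun _ => c) t = c * r := by
  rw [setIntegral_indicator measurableSet_Iio, Ioi_inter_Iio]
  simp [hr, mul_comm]

/-- If `D` vanishes at `0`, is nonpositive before the mode of `g` and nonnegative after it, then
the integral of `D'` against `g` is nonnegative. -/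
lemma integral_deriv_mul_nonneg_of_isModeOn (hg : AEMeasurable g volume)
    (hfin : ∫⁻ x in Ioi (0 : ℝ), g x ≠ ∞) (h : IsModeOn (Ioi 0) g m)
    (hD : ∀ x > 0, HasDerivAt D (d x) x) (h0 : Tendsto D (𝓝[>] 0) (𝓝 0))
    (hdm : Measurable d) {C : ℝ} (hC : ∀ x > 0, |d x| ≤ C)
    (hle : ∀ x, 0 < x → x ≤ m → D x ≤ 0) (hge : ∀ x, 0 < x → m ≤ x → 0 ≤ D x) :
    0 ≤ ∫ x in Ioi (0 : ℝ), d x * (g x).toReal := by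
  set G : ℝ → ℝ := fun x => (g x).toReal with hG
  set ν := volume.restrict (Ioi (0 : ℝ)) with hν
  have hGi : Integrable G ν := integrableOn_toReal hg hfin
  -- Integrating F x over t > 0 gives d(x) G(x); integrating first over x gives the integral of d
  -- over a superlevel set. Fubini equates the two.
  set F : ℝ → ℝ → ℝ := fun x t => (Iio (G x)).indicator (fun _ => d x) t with hF
  have hFm : AEStronglyMeasurable (Function.uncurry F) (ν.prod ν) := by
    have h1 : Function.uncurry F
        = {p : ℝ × ℝ | p.2 < G p.1}.indicator (fun p => d p.1) := by
      ext p; simp [F, Function.uncurry, indicator]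
    rw [h1]
    refine AEStronglyMeasurable.indicator₀ ?_ ?_
    · exact (hdm.comp measurable_fst).aestronglyMeasurable
    · exact nullMeasurableSet_lt measurable_snd.aemeasurable hGi.aemeasurable.comp_fst
  have hFi : Integrable (Function.uncurry F) (ν.prod ν) := by
    rw [integrable_prod_iff hFm]
    refine ⟨ae_of_all _ fun x => integrableOn_Ioi_indicator_lt (d x) (G x), ?_⟩
    have h2 : ∀ x, ∫ t, ‖Function.uncurry F (x, t)‖ ∂ν = ‖d x‖ * G x := by
      intro x
      rw [← integral_Ioi_indicator_lt ‖d x‖ (r := G x) ENNReal.toReal_nonneg]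
      simp only [Function.uncurry, F, norm_indicator_eq_indicator_norm]
      rfl
    simp only [h2]
    refine hGi.bdd_mul (c := C) hdm.norm.aestronglyMeasurable ?_
    filter_upwards [ae_restrict_mem measurableSet_Ioi] with x hx
    simpa using hC x hx
  have hswap := integral_integral_swap hFi
  have h3 : ∀ x, ∫ t, F x t ∂ν = d x * G x := fun x =>
    integral_Ioi_indicator_lt (d x) ENNReal.toReal_nonneg
  simp only [h3] at hswap
  rw [hswap]
  refine setIntegral_nonneg measurableSet_Ioi fun t (ht : 0 < t) => ?_
  have hs : ENNReal.ofReal t ≠ 0 := by simpa using ht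
  refine (setIntegral_superlevel_nonneg hfin h hD h0 hdm hC hle hge hs).trans_eq ?_
  have hTm : MeasurableSet {x | 0 < x ∧ ENNReal.ofReal t < g x} :=
    (h.ordConnected_superlevel _).measurableSet
  have hsub : {x | 0 < x ∧ ENNReal.ofReal t < g x} ⊆ Ioi 0 := fun x hx => hx.1
  rw [← inter_eq_self_of_subset_right hsub, ← setIntegral_indicator hTm]
  refine integral_congr_ae ?_
  filter_upwards [ae_lt_top' (hg.restrict (s := Ioi 0)) hfin, ae_restrict_mem measurableSet_Ioi]
    with x hx (hx0 : 0 < x)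
  simp [F, G, indicator, hx0, ENNReal.ofReal_lt_iff_lt_toReal ht.le hx.ne]

end LayerCake

/-! ### Normal tails and total positivity -/

/-- The standard normal upper tail. -/
noncomputable def normalTail (v : ℝ) : ℝ := (gaussianReal 0 1).real (Ioi v)

lemma normalTail_eq_integral (v : ℝ) :
    normalTail v = ∫ t in Ioi v, gaussianPDFReal 0 1 t := by
  rw [normalTail, measureReal_def, gaussianReal_apply_eq_integral _ one_ne_zero,
    ENNReal.toReal_ofReal]
  exact integral_nonneg fun t => gaussianPDFReal_nonneg _ _ _

lemma hasDerivAt_normalTail (v : ℝ) :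
    HasDerivAt normalTail (-((√(2 * Real.pi))⁻¹ * Real.exp (-v ^ 2 / 2))) v := by
  have hint := integrable_gaussianPDFReal 0 1
  have hc : Continuous (gaussianPDFReal 0 1) := by unfold gaussianPDFReal; fun_prop
  have h1 : normalTail = fun v => normalTail 0 - ∫ t in (0 : ℝ)..v, gaussianPDFReal 0 1 t := by
    ext v
    rw [normalTail_eq_integral, normalTail_eq_integral,
      ← intervalIntegral.integral_Ioi_sub_Ioi' hint.integrableOn hint.integrableOn]
    ring
  rw [h1]
  have h2 := (hc.integral_hasStrictDerivAt 0 v).hasDerivAt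
  refine (h2.const_sub _).congr_deriv ?_
  simp [gaussianPDFReal]

lemma normalTail_eq_one_sub_cdf (v : ℝ) : normalTail v = 1 - cdf (gaussianReal 0 1) v := by
  rw [normalTail, cdf_eq_real, ← compl_Iic, probReal_compl_eq_one_sub measurableSet_Iic]

lemma tendsto_normalTail_atTop : Tendsto normalTail atTop (𝓝 0) := by
  have h := (tendsto_cdf_atTop (gaussianReal 0 1)).const_sub 1
  rw [sub_self] at h
  exact h.congr fun v => (normalTail_eq_one_sub_cdf v).symm

lemma tendsto_normalTail_atBot : Tendsto normalTail atBot (𝓝 1) := by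
  have h := (tendsto_cdf_atBot (gaussianReal 0 1)).const_sub 1
  rw [sub_zero] at h
  exact h.congr fun v => (normalTail_eq_one_sub_cdf v).symm

/-- The normalising factors agree, and the exponents differ by (z² - y²)(1/x - 1/m)/2 ≥ 0. -/
lemma mixKernel_zero_mul_le {x m y z : ℝ} (hx : 0 < x) (hxm : x ≤ m) (hy : 0 ≤ y) (hyz : y ≤ z) :
    mixKernel 0 x z * mixKernel 0 m y ≤ mixKernel 0 m z * mixKernel 0 x y := by
  have hm : 0 < m := hx.trans_le hxm
  unfold mixKernel
  rw [mul_mul_mul_comm (√(2 * Real.pi * x))⁻¹, mul_mul_mul_comm (√(2 * Real.pi * m))⁻¹,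
    ← Real.exp_add, ← Real.exp_add, mul_comm (√(2 * Real.pi * m))⁻¹]
  gcongr _ * Real.exp ?_
  have h1 : y ^ 2 ≤ z ^ 2 := by gcongr
  have h2 : 1 / m ≤ 1 / x := by gcongr
  have h3 : ∀ u v : ℝ, -(u - 0 * v) ^ 2 / (2 * v) = -(u ^ 2) * (1 / v) / 2 := by
    intro u v; rw [zero_mul, sub_zero, mul_one_div, div_div, mul_comm v 2]
  simp only [h3]
  nlinarith [mul_nonneg (sub_nonneg.2 h1) (sub_nonneg.2 h2)]

/-- Total positivity of order two of the normal kernel. -/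
lemma mixKernel_mul_le (β : ℝ) {x m y z : ℝ} (hx : 0 < x) (hxm : x ≤ m) (hy : 0 ≤ y)
    (hyz : y ≤ z) : mixKernel β x z * mixKernel β m y ≤ mixKernel β m z * mixKernel β x y := by
  have hm : 0 < m := hx.trans_le hxm
  rw [mixKernel_eq_exp_mul β hx z, mixKernel_eq_exp_mul β hm y, mixKernel_eq_exp_mul β hm z,
    mixKernel_eq_exp_mul β hx y]
  have h := mul_le_mul_of_nonneg_left (mixKernel_zero_mul_le hx hxm hy hyz)
    (by positivity : 0 ≤ Real.exp (β * z) * Real.exp (β * y) * Real.exp (-β ^ 2 / 2 * x)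
      * Real.exp (-β ^ 2 / 2 * m))
  linarith

/-- The probability that a normal variable with mean `-β * x` and variance `x` exceeds `y`. -/
noncomputable def tailProb (β y x : ℝ) : ℝ := normalTail ((y + β * x) / √x)

lemma ofReal_tailProb (β y : ℝ) {x : ℝ} (hx : 0 < x) :
    ENNReal.ofReal (tailProb β y x) = ∫⁻ z in Ioi y, ENNReal.ofReal (mixKernel (-β) x z) := by
  have h0 : Real.toNNReal x ≠ 0 := by simpa using hx
  have hs : 0 < √x := Real.sqrt_pos.2 hx
  have h1 := gaussianReal_zero_one_preimage (-β * x) (√x) (measurableSet_Ioi (a := y))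
    (Real.sq_sqrt hx.le)
  rw [gaussianReal_apply _ h0] at h1
  have h2 : (fun z => -β * x + √x * z) ⁻¹' Ioi y = Ioi ((y + β * x) / √x) := by
    ext z
    simp only [mem_preimage, mem_Ioi, div_lt_iff₀ hs]
    constructor <;> intro h <;> linarith
  rw [tailProb, normalTail, ofReal_measureReal, ← h2, h1]
  refine setLIntegral_congr_fun measurableSet_Ioi fun z _ => ?_
  rw [gaussianPDF, gaussianPDFReal_eq_mixKernel _ hx.le]

lemma tailProb_pos (β y : ℝ) {x : ℝ} (hx : 0 < x) : 0 < tailProb β y x := by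
  rw [← ENNReal.ofReal_pos, ofReal_tailProb β y hx, pos_iff_ne_zero, Ne,
    lintegral_eq_zero_iff (by fun_prop)]
  intro h
  have h1 : ∀ᵐ z ∂(volume.restrict (Ioi y)), False := by
    filter_upwards [h] with z hz
    have := mixKernel_pos (-β) hx z
    simp [this.not_ge] at hz
  rw [ae_iff, show {_a : ℝ | ¬ False} = univ by simp, Measure.restrict_apply_univ,
    Real.volume_Ioi] at h1
  exact ENNReal.top_ne_zero h1

lemma tailProb_anti (β : ℝ) {x y z : ℝ} (hx : 0 < x) (hyz : y ≤ z) :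
    tailProb β z x ≤ tailProb β y x := by
  rw [← ENNReal.ofReal_le_ofReal_iff (tailProb_pos β y hx).le, ofReal_tailProb β y hx,
    ofReal_tailProb β z hx]
  exact lintegral_mono_set (Ioi_subset_Ioi hyz)

/-- Total positivity of order two of the normal tail. -/
lemma tailProb_mul_le (β : ℝ) {x m y z : ℝ} (hx : 0 < x) (hxm : x ≤ m) (hy : 0 ≤ y)
    (hyz : y ≤ z) : tailProb β z x * tailProb β y m ≤ tailProb β z m * tailProb β y x := by
  have hm : 0 < m := hx.trans_le hxm
  have hmeas : ∀ u, Measurable fun w => ENNReal.ofReal (mixKernel (-β) u w) := by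
    intro u; fun_prop
  rw [← ENNReal.ofReal_le_ofReal_iff
    (mul_nonneg (tailProb_pos β z hm).le (tailProb_pos β y hx).le),
    ENNReal.ofReal_mul (tailProb_pos β z hx).le, ENNReal.ofReal_mul (tailProb_pos β z hm).le]
  simp only [ofReal_tailProb β _ hx, ofReal_tailProb β _ hm]
  -- Splitting the half-line above y at z, the product of the two tails above z occurs on both
  -- sides. In the remaining double integrals u ≤ z < w, so the inequality for the kernel applies
  -- pointwise.
  rw [← Ioc_union_Ioi_eq_Ioi hyz, lintegral_union measurableSet_Ioi (Ioc_disjoint_Ioi le_rfl),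
    lintegral_union measurableSet_Ioi (Ioc_disjoint_Ioi le_rfl), mul_add, mul_add]
  refine add_le_add ?_ (mul_comm _ _).le
  rw [← lintegral_lintegral_mul (hmeas x).aemeasurable (hmeas m).aemeasurable,
    ← lintegral_lintegral_mul (hmeas m).aemeasurable (hmeas x).aemeasurable]
  refine setLIntegral_mono' measurableSet_Ioi fun w (hw : z < w) => ?_
  refine setLIntegral_mono' measurableSet_Ioc fun u hu => ?_
  rw [← ENNReal.ofReal_mul (mixKernel_nonneg _ _ _), ← ENNReal.ofReal_mul (mixKernel_nonneg _ _ _)]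
  exact ENNReal.ofReal_le_ofReal
    (mixKernel_mul_le (-β) hx hxm (hy.trans hu.1.le) (hu.2.trans hw.le))

/-- The derivative of `tailProb β y`. -/
noncomputable def tailRate (β y x : ℝ) : ℝ :=
  -(1 / 2) * Real.exp (-(2 * β * y)) * ((β - y / x) * mixKernel β x y)

lemma measurable_tailRate (β y : ℝ) : Measurable (tailRate β y) := by
  unfold tailRate; fun_prop

/-- This is why the drift of the tail has the opposite sign: k_{-β}(x, y) = exp(-2βy) k_β(x, y), and
the forward equation turns the x-derivative of the tail into a multiple, free of x, of the
y-derivative of k_β. -/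
lemma hasDerivAt_tailProb (β y : ℝ) {x : ℝ} (hx : 0 < x) :
    HasDerivAt (tailProb β y) (tailRate β y x) x := by
  have hs : 0 < √x := Real.sqrt_pos.2 hx
  have h1 : HasDerivAt (fun x => (y + β * x) / √x) ((β - y / x) / (2 * √x)) x := by
    have h2 : HasDerivAt (fun x => y + β * x) β x := by
      simpa using ((hasDerivAt_id x).const_mul β).const_add y
    refine (h2.div (Real.hasDerivAt_sqrt hx.ne') hs.ne').congr_deriv ?_
    have h3 : √x ^ 2 = x := Real.sq_sqrt hx.le
    rw [h3]
    field_simp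
    rw [h3]
    ring
  refine ((hasDerivAt_normalTail _).comp x h1).congr_deriv ?_
  rw [tailRate, mixKernel, Real.sqrt_mul (by positivity : 0 ≤ 2 * Real.pi) x]
  have h4 : Real.exp (-((y + β * x) / √x) ^ 2 / 2)
      = Real.exp (-(2 * β * y)) * Real.exp (-(y - β * x) ^ 2 / (2 * x)) := by
    rw [← Real.exp_add, div_pow, Real.sq_sqrt hx.le]
    congr 1
    field_simp
    ring
  rw [h4]
  field_simp

lemma tendsto_tailProb_nhdsGT (β : ℝ) {y : ℝ} (hy : 0 < y) :
    Tendsto (tailProb β y) (𝓝[>] 0) (𝓝 0) := by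
  refine tendsto_normalTail_atTop.comp ?_
  have h1 : Tendsto (fun x : ℝ => √x) (𝓝[>] 0) (𝓝[>] 0) := by
    refine tendsto_nhdsWithin_iff.2 ⟨?_, ?_⟩
    · have := (Real.continuous_sqrt.tendsto 0).mono_left (nhdsWithin_le_nhds (s := Ioi 0))
      simpa using this
    · filter_upwards [self_mem_nhdsWithin] with x hx
      exact Real.sqrt_pos.2 hx
  have h2 : Tendsto (fun x : ℝ => (√x)⁻¹) (𝓝[>] 0) atTop := tendsto_inv_nhdsGT_zero.comp h1
  have h3 : Tendsto (fun x : ℝ => y + β * x) (𝓝[>] 0) (𝓝 y) := by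
    have : Continuous fun x : ℝ => y + β * x := by fun_prop
    have := (this.tendsto 0).mono_left (nhdsWithin_le_nhds (s := Ioi 0))
    simpa using this
  exact h3.pos_mul_atTop hy h2

lemma tailRate_bound (β : ℝ) {y : ℝ} (hy : 0 < y) : ∃ C, ∀ x > 0, |tailRate β y x| ≤ C := by
  obtain ⟨C, hC⟩ := mixKernel_bounds β hy
  refine ⟨|-(1 / 2) * Real.exp (-(2 * β * y))| * C, fun x hx => ?_⟩
  rw [tailRate, abs_mul]
  gcongr
  exact (hC y ⟨by linarith, by linarith⟩ x hx).2

/-! ### Sign of the derivative of the mixture, and unimodality -/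

section

variable {g : ℝ → ℝ≥0∞} {β : ℝ}

lemma integrableOn_tailRate_mul (hg : AEMeasurable g volume)
    (hfin : ∫⁻ x in Ioi (0 : ℝ), g x ≠ ∞) {y : ℝ} (hy : 0 < y) :
    IntegrableOn (fun x => tailRate β y x * (g x).toReal) (Ioi 0) := by
  refine Integrable.congr ((integrableOn_deriv_mixKernel_mul β hg hfin hy).const_mul
    (-(1 / 2) * Real.exp (-(2 * β * y)))) (ae_of_all _ fun x => ?_)
  simp only [tailRate]; ring

lemma stdMixtureDeriv_eq (y : ℝ) :
    stdMixtureDeriv β g y = -(2 * Real.exp (2 * β * y)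
      * ∫ x in Ioi (0 : ℝ), tailRate β y x * (g x).toReal) := by
  rw [← integral_const_mul, ← integral_neg, stdMixtureDeriv]
  refine setIntegral_congr_fun measurableSet_Ioi fun x _ => ?_
  have h : Real.exp (2 * β * y) * Real.exp (-(2 * β * y)) = 1 := by
    rw [← Real.exp_add]; simp
  simp only [tailRate]
  linear_combination -((β - y / x) * mixKernel β x y * (g x).toReal) * h

lemma stdMixtureDeriv_nonpos_iff (y : ℝ) :
    stdMixtureDeriv β g y ≤ 0 ↔ 0 ≤ ∫ x in Ioi (0 : ℝ), tailRate β y x * (g x).toReal := by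
  rw [stdMixtureDeriv_eq, neg_nonpos, mul_nonneg_iff_of_pos_left (by positivity)]

lemma stdMixtureDeriv_nonneg_iff (y : ℝ) :
    0 ≤ stdMixtureDeriv β g y ↔ ∫ x in Ioi (0 : ℝ), tailRate β y x * (g x).toReal ≤ 0 := by
  rw [stdMixtureDeriv_eq, neg_nonneg]
  have : 0 < 2 * Real.exp (2 * β * y) := by positivity
  constructor
  · exact fun h => nonpos_of_mul_nonpos_right h this
  · exact fun h => mul_nonpos_of_nonneg_of_nonpos this.le h

/-- A linear combination of two normal tails whose sign changes at the mode of `g`. -/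
lemma integral_tailRate_comb_nonneg (hg : AEMeasurable g volume)
    (hfin : ∫⁻ x in Ioi (0 : ℝ), g x ≠ ∞) {m : ℝ} (h : IsModeOn (Ioi 0) g m) {y z a b : ℝ}
    (hy : 0 < y) (hz : 0 < z)
    (hle : ∀ x, 0 < x → x ≤ m → a * tailProb β y x - b * tailProb β z x ≤ 0)
    (hge : ∀ x, 0 < x → m ≤ x → 0 ≤ a * tailProb β y x - b * tailProb β z x) :
    b * ∫ x in Ioi (0 : ℝ), tailRate β z x * (g x).toReal
      ≤ a * ∫ x in Ioi (0 : ℝ), tailRate β y x * (g x).toReal := by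
  obtain ⟨C, hC⟩ := tailRate_bound β hy
  obtain ⟨C', hC'⟩ := tailRate_bound β hz
  have h0 : Tendsto (fun x => a * tailProb β y x - b * tailProb β z x) (𝓝[>] 0) (𝓝 0) := by
    simpa using ((tendsto_tailProb_nhdsGT β hy).const_mul a).sub
      ((tendsto_tailProb_nhdsGT β hz).const_mul b)
  have key := integral_deriv_mul_nonneg_of_isModeOn (C := |a| * C + |b| * C') hg hfin h
    (fun x hx => ((hasDerivAt_tailProb β y hx).const_mul a).sub
      ((hasDerivAt_tailProb β z hx).const_mul b)) h0
    (((measurable_tailRate β y).const_mul a).sub ((measurable_tailRate β z).const_mul b))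
    (fun x hx => by
      refine (abs_sub _ _).trans ?_
      rw [abs_mul, abs_mul]
      gcongr
      · exact hC x hx
      · exact hC' x hx) hle hge
  have h1 : ∀ x, (a * tailRate β y x - b * tailRate β z x) * (g x).toReal
      = a * (tailRate β y x * (g x).toReal) - b * (tailRate β z x * (g x).toReal) := by
    intro x; ring
  simp only [h1] at key
  rw [integral_sub ((integrableOn_tailRate_mul hg hfin hy).const_mul a)
    ((integrableOn_tailRate_mul hg hfin hz).const_mul b), integral_const_mul,
    integral_const_mul] at key
  linarith

/-- For m ≤ 0 only the sign of D after the mode matters, and the tail itself serves as D. -/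
lemma stdMixtureDeriv_nonpos_of_antitoneOn (hg : AEMeasurable g volume)
    (hfin : ∫⁻ x in Ioi (0 : ℝ), g x ≠ ∞) {m : ℝ} (hm : m ≤ 0) (h : IsModeOn (Ioi 0) g m)
    {y : ℝ} (hy : 0 < y) : stdMixtureDeriv β g y ≤ 0 := by
  have := integral_tailRate_comb_nonneg (β := β) (a := 1) (b := 0) hg hfin h hy hy
    (fun x hx hxm => by linarith) (fun x hx _ => by simpa using (tailProb_pos β y hx).le)
  rw [stdMixtureDeriv_nonpos_iff]
  simpa using this

lemma stdMixtureDeriv_nonpos_of_le (hg : AEMeasurable g volume)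
    (hfin : ∫⁻ x in Ioi (0 : ℝ), g x ≠ ∞) (h : UnimodalOn (Ioi 0) g)
    {y z : ℝ} (hy : 0 < y) (hyz : y ≤ z) (hd : stdMixtureDeriv β g y ≤ 0) :
    stdMixtureDeriv β g z ≤ 0 := by
  obtain ⟨m, h⟩ := h
  have hz := hy.trans_le hyz
  rcases le_or_gt m 0 with hm | hm
  · exact stdMixtureDeriv_nonpos_of_antitoneOn hg hfin hm h hz
  -- The coefficients make the combination vanish at x = m; total positivity then gives the change
  -- of sign from - to +.
  have key := integral_tailRate_comb_nonneg (β := β) (a := tailProb β y m) (b := tailProb β z m)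
    hg hfin h hz hy
    (fun x hx hxm => by linarith [tailProb_mul_le β hx hxm hy.le hyz])
    (fun x hx hmx => by linarith [tailProb_mul_le β hm hmx hy.le hyz])
  rw [stdMixtureDeriv_nonpos_iff] at hd ⊢
  have h1 := mul_nonneg (tailProb_pos β z hm).le hd
  exact nonneg_of_mul_nonneg_right (h1.trans key) (tailProb_pos β y hm)

lemma exists_gt_stdMixtureDeriv_neg (hg : AEMeasurable g volume)
    (hfin : ∫⁻ x in Ioi (0 : ℝ), g x ≠ ∞) (hpos : ∫⁻ x in Ioi (0 : ℝ), g x ≠ 0) {y : ℝ}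
    (hy : 0 < y) : ∃ z, y < z ∧ stdMixtureDeriv β g z < 0 := by
  by_contra! hcon
  refine not_monotoneOn_stdMixture_Ici β hg hfin hpos y
    (stdMixture_monotoneOn β hg hfin (convex_Ici y) (fun z hz => hy.trans_le hz) fun z hz => ?_)
  rw [interior_Ici] at hz
  exact hcon z hz

/-- Strictness is imported from a point z > y with negative derivative. For decreasing g, the
difference of the tails at y and z is nonnegative and serves as D. For β = 0, f'(y)/y is minus the
integral of k(x, y) g(x)/x, which is increasing in y. -/
lemma stdMixtureDeriv_neg (hg : AEMeasurable g volume)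
    (hfin : ∫⁻ x in Ioi (0 : ℝ), g x ≠ ∞) (hpos : ∫⁻ x in Ioi (0 : ℝ), g x ≠ 0)
    (h : AntitoneOn g (Ioi 0) ∨ β = 0) {y : ℝ} (hy : 0 < y) : stdMixtureDeriv β g y < 0 := by
  obtain ⟨z, hyz, hz⟩ := exists_gt_stdMixtureDeriv_neg (β := β) hg hfin hpos hy
  have hz0 := hy.trans hyz
  rcases h with h | rfl
  · have hmode : IsModeOn (Ioi 0) g 0 := by
      refine ⟨?_, h.mono inter_subset_left⟩
      rintro x ⟨hx, hx'⟩
      exact absurd (mem_Ioi.1 hx) (not_lt.2 hx')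
    have key := integral_tailRate_comb_nonneg (β := β) (a := 1) (b := 1) hg hfin hmode hy hz0
      (fun x hx hxm => by linarith) (fun x hx _ => by linarith [tailProb_anti β hx hyz.le])
    rw [← not_le, stdMixtureDeriv_nonneg_iff] at hz ⊢
    linarith
  · have h1 : stdMixtureDeriv 0 g y ≤ y / z * stdMixtureDeriv 0 g z := by
      unfold stdMixtureDeriv
      rw [← integral_const_mul]
      refine setIntegral_mono_on (integrableOn_deriv_mixKernel_mul 0 hg hfin hy)
        ((integrableOn_deriv_mixKernel_mul 0 hg hfin hz0).const_mul _) measurableSet_Ioi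
        fun x (hx : 0 < x) => ?_
      have h2 : mixKernel 0 x z ≤ mixKernel 0 x y :=
        mixKernel_le_mixKernel hx (by simp only [zero_mul, sub_zero]; gcongr)
      have h3 : y / z * ((0 - z / x) * mixKernel 0 x z * (g x).toReal)
          = -(y / x * (g x).toReal * mixKernel 0 x z) := by
        field_simp; ring
      rw [h3]
      have h4 : 0 ≤ y / x * (g x).toReal := by positivity
      nlinarith [mul_le_mul_of_nonneg_left h2 h4]
    have h5 : y / z * stdMixtureDeriv 0 g z < 0 := mul_neg_of_pos_of_neg (by positivity) hz
    linarith

lemma stdMixture_antitoneOn_Ici_zero (hg : AEMeasurable g volume)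
    (h : AntitoneOn (stdMixture β g) (Ioi 0)) : AntitoneOn (stdMixture β g) (Ici 0) := by
  intro y hy z hz hyz
  rcases (mem_Ici.1 hy).eq_or_lt with rfl | hy
  · rcases hyz.eq_or_lt with rfl | hz
    · exact le_rfl
    · refine ge_of_tendsto (tendsto_stdMixture_nhdsGT β hg) ?_
      filter_upwards [Ioo_mem_nhdsGT hz] with u hu
      exact h hu.1 hz hu.2.le
  · exact h hy (hy.trans_le hyz) hyz

lemma stdMixture_monotoneOn_Icc_zero (hg : AEMeasurable g volume) {c : ℝ}
    (h : MonotoneOn (stdMixture β g) (Ioc 0 c)) : MonotoneOn (stdMixture β g) (Icc 0 c) := by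
  intro y hy z hz hyz
  rcases hy.1.eq_or_lt with rfl | hy0
  · rcases hyz.eq_or_lt with rfl | hz0
    · exact le_rfl
    · refine le_of_tendsto (tendsto_stdMixture_nhdsGT β hg) ?_
      filter_upwards [Ioo_mem_nhdsGT hz0] with u hu
      exact h ⟨hu.1, hu.2.le.trans hz.2⟩ ⟨hz0, hz.2⟩ hu.2.le
  · exact h ⟨hy0, hy.2⟩ ⟨hy0.trans_le hyz, hz.2⟩ hyz

lemma stdMixture_unimodal_of_nonneg (hβ : 0 ≤ β) (hg : AEMeasurable g volume)
    (hfin : ∫⁻ x in Ioi (0 : ℝ), g x ≠ ∞) (hpos : ∫⁻ x in Ioi (0 : ℝ), g x ≠ 0)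
    (h : UnimodalOn (Ioi 0) g) : UnimodalOn univ (stdMixture β g) := by
  -- Within (0, ∞), S is closed upwards, so its infimum separates increase from decrease and is the
  -- mode. The infimum may be 0, where the derivative is not available and right continuity takes
  -- over.
  set S := {y : ℝ | 0 < y ∧ stdMixtureDeriv β g y ≤ 0} with hS
  obtain ⟨s, hs, hs'⟩ := exists_gt_stdMixtureDeriv_neg (β := β) hg hfin hpos one_pos
  have hsS : s ∈ S := ⟨one_pos.trans hs, hs'.le⟩
  have hbb : BddBelow S := ⟨0, fun y hy => hy.1.le⟩
  have hup : ∀ y, sInf S < y → stdMixtureDeriv β g y ≤ 0 := by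
    intro y hy
    obtain ⟨u, hu, huy⟩ := exists_lt_of_csInf_lt ⟨s, hsS⟩ hy
    exact stdMixtureDeriv_nonpos_of_le hg hfin h hu.1 huy.le hu.2
  have hc0 : 0 ≤ sInf S := le_csInf ⟨s, hsS⟩ fun y hy => hy.1.le
  have hleft := stdMixture_monotoneOn_Iic hβ g
  refine ⟨sInf S, ?_, ?_⟩
  · rw [univ_inter]
    have h1 : MonotoneOn (stdMixture β g) (Icc 0 (sInf S)) := by
      refine stdMixture_monotoneOn_Icc_zero hg (stdMixture_monotoneOn β hg hfin (convex_Ioc _ _)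
        Ioc_subset_Ioi_self fun y hy => ?_)
      rw [interior_Ioc] at hy
      by_contra! hlt
      exact absurd (csInf_le hbb (⟨hy.1, hlt.le⟩ : y ∈ S)) (not_le.2 hy.2)
    rw [← Iic_union_Icc_eq_Iic hc0]
    exact hleft.union_right h1 isGreatest_Iic (isLeast_Icc hc0)
  · rw [univ_inter]
    rcases hc0.eq_or_lt with hc | hc
    · rw [← hc]
      refine stdMixture_antitoneOn_Ici_zero hg (stdMixture_antitoneOn β hg hfin (convex_Ioi _)
        le_rfl fun y hy => hup y ?_)
      rw [interior_Ioi] at hy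
      rwa [← hc]
    · refine stdMixture_antitoneOn β hg hfin (convex_Ici _) (fun y hy => hc.trans_le hy)
        fun y hy => hup y ?_
      rwa [interior_Ici] at hy

lemma IsModeOn.comp_neg {f : ℝ → ℝ≥0∞} {m : ℝ} (h : IsModeOn univ f m) :
    IsModeOn univ (fun y => f (-y)) (-m) := by
  constructor
  · intro y hy z hz hyz
    exact h.2 ⟨trivial, by simpa [le_neg] using hz.2⟩ ⟨trivial, by simpa [le_neg] using hy.2⟩
      (neg_le_neg hyz)
  · intro y hy z hz hyz
    exact h.1 ⟨trivial, by simpa [neg_le] using hz.2⟩ ⟨trivial, by simpa [neg_le] using hy.2⟩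
      (neg_le_neg hyz)

lemma stdMixture_eq_comp_neg : stdMixture β g = fun y => stdMixture (-β) g (-y) := by
  ext y; rw [stdMixture_neg, neg_neg]

theorem stdMixture_unimodal (hg : AEMeasurable g volume)
    (hfin : ∫⁻ x in Ioi (0 : ℝ), g x ≠ ∞) (hpos : ∫⁻ x in Ioi (0 : ℝ), g x ≠ 0)
    (h : UnimodalOn (Ioi 0) g) : UnimodalOn univ (stdMixture β g) := by
  rcases le_total 0 β with hβ | hβ
  · exact stdMixture_unimodal_of_nonneg hβ hg hfin hpos h
  · obtain ⟨m, hm⟩ := stdMixture_unimodal_of_nonneg (neg_nonneg.2 hβ) hg hfin hpos h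
    rw [stdMixture_eq_comp_neg]
    exact ⟨-m, hm.comp_neg⟩

theorem stdMixture_isModeOn_zero (hg : AEMeasurable g volume)
    (hfin : ∫⁻ x in Ioi (0 : ℝ), g x ≠ ∞) (hpos : ∫⁻ x in Ioi (0 : ℝ), g x ≠ 0)
    (h : AntitoneOn g (Ioi 0) ∨ β = 0) : IsModeOn univ (stdMixture β g) 0 := by
  have key : ∀ b : ℝ, (AntitoneOn g (Ioi 0) ∨ b = 0) → AntitoneOn (stdMixture b g) (Ici 0) := by
    intro b hb
    refine stdMixture_antitoneOn_Ici_zero hg (stdMixture_antitoneOn b hg hfin (convex_Ioi _)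
      le_rfl fun y hy => ?_)
    rw [interior_Ioi] at hy
    exact (stdMixtureDeriv_neg hg hfin hpos hb hy).le
  refine ⟨?_, by simpa using key β h⟩
  rw [stdMixture_eq_comp_neg]
  intro y hy z hz hyz
  exact key (-β) (by simpa using h) (by simpa using hz.2) (by simpa using hy.2) (neg_le_neg hyz)

lemma not_isLocalMax_stdMixture_of_pos (hg : AEMeasurable g volume)
    (hfin : ∫⁻ x in Ioi (0 : ℝ), g x ≠ ∞) (hpos : ∫⁻ x in Ioi (0 : ℝ), g x ≠ 0)
    (h : AntitoneOn g (Ioi 0) ∨ β = 0) {y : ℝ} (hy : 0 < y) :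
    ¬ IsLocalMax (stdMixture β g) y := by
  intro hmax
  have h1 : IsLocalMax (fun y => (stdMixture β g y).toReal) y := by
    filter_upwards [hmax] with z hz
    exact ENNReal.toReal_mono (stdMixture_lt_top β hfin hy).ne hz
  exact (stdMixtureDeriv_neg hg hfin hpos h hy).ne
    (h1.hasDerivAt_eq_zero (hasDerivAt_stdMixture β hg hfin hy))

theorem not_isLocalMax_stdMixture (hg : AEMeasurable g volume)
    (hfin : ∫⁻ x in Ioi (0 : ℝ), g x ≠ ∞) (hpos : ∫⁻ x in Ioi (0 : ℝ), g x ≠ 0)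
    (h : AntitoneOn g (Ioi 0) ∨ β = 0) {y : ℝ} (hy : y ≠ 0) :
    ¬ IsLocalMax (stdMixture β g) y := by
  rcases hy.lt_or_gt with hy | hy
  · intro hmax
    refine not_isLocalMax_stdMixture_of_pos (β := -β) hg hfin hpos (by simpa using h)
      (neg_pos.2 hy) ?_
    have h1 : Tendsto (fun z : ℝ => -z) (𝓝 (-y)) (𝓝 y) := by
      simpa using (continuous_neg.tendsto (-y) : Tendsto (fun z : ℝ => -z) _ _)
    filter_upwards [h1.eventually hmax] with z hz
    rw [stdMixture_neg] at hz
    rwa [stdMixture_neg, neg_neg]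
  · exact not_isLocalMax_stdMixture_of_pos hg hfin hpos h hy

end

/-! ### First-passage decomposition of the driftless kernel -/

/-- The density at time `s` of the first passage of Brownian motion through the level `δ`. -/
noncomputable def hittingDensity (δ s : ℝ) : ℝ := δ / s * mixKernel 0 s δ

lemma hittingDensity_nonneg {δ s : ℝ} (hδ : 0 ≤ δ) (hs : 0 ≤ s) : 0 ≤ hittingDensity δ s :=
  mul_nonneg (div_nonneg hδ hs) (mixKernel_nonneg _ _ _)

lemma measurable_hittingDensity (δ : ℝ) : Measurable (hittingDensity δ) := by
  unfold hittingDensity; fun_prop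

/-- The prefactor δ/s is a function of δ times a function of s, so total positivity is inherited
from the kernel. -/
lemma hittingDensity_mul_le {s t δ ε : ℝ} (hs : 0 < s) (hst : s ≤ t) (hδ : 0 ≤ δ) (hδε : δ ≤ ε) :
    hittingDensity δ t * hittingDensity ε s ≤ hittingDensity δ s * hittingDensity ε t := by
  have ht : 0 < t := hs.trans_le hst
  have hε : 0 ≤ ε := hδ.trans hδε
  have h := mul_le_mul_of_nonneg_left (mixKernel_zero_mul_le hs hst hδ hδε)
    (by positivity : 0 ≤ (δ / s) * (ε / t))
  have e1 : hittingDensity δ t * hittingDensity ε s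
      = (δ / s) * (ε / t) * (mixKernel 0 s ε * mixKernel 0 t δ) := by
    unfold hittingDensity; ring
  have e2 : hittingDensity δ s * hittingDensity ε t
      = (δ / s) * (ε / t) * (mixKernel 0 t ε * mixKernel 0 s δ) := by
    unfold hittingDensity; ring
  rwa [e1, e2]

section Convolution

variable {x y δ : ℝ}

/-- An antiderivative of `s ↦ hittingDensity δ s * mixKernel 0 (x - s) y`. -/
noncomputable def hittingPrimitive (x y δ s : ℝ) : ℝ :=
  mixKernel 0 x (y + δ) * normalTail (δ * √(1 / s - 1 / x) - y * √(1 / (x - s) - 1 / x))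
    + mixKernel 0 x (y - δ) * normalTail (δ * √(1 / s - 1 / x) + y * √(1 / (x - s) - 1 / x))

/-- With A = 1/s - 1/x and B = 1/(x-s) - 1/x one has √A √B = 1/x. Completing the square shows that
k(x, y ± δ) exp(-(δ√A ∓ y√B)²/2) is the same for both signs. Hence the contributions of the
derivative of √B cancel and those of √A add up. -/
lemma hasDerivAt_hittingPrimitive {s : ℝ} (hs : 0 < s) (hsx : s < x) :
    HasDerivAt (hittingPrimitive x y δ) (hittingDensity δ s * mixKernel 0 (x - s) y) s := by
  have hx : 0 < x := hs.trans hsx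
  have hxs : 0 < x - s := sub_pos.2 hsx
  set A := 1 / s - 1 / x with hA
  set B := 1 / (x - s) - 1 / x with hB
  have hA' : A = (x - s) / (s * x) := by rw [hA]; field_simp
  have hB' : B = s / ((x - s) * x) := by rw [hB]; field_simp; ring
  have hA0 : 0 < A := by rw [hA']; positivity
  have hB0 : 0 < B := by rw [hB']; positivity
  have hAB : √A * √B = 1 / x := by
    rw [← Real.sqrt_mul hA0.le, hA', hB',
      show (x - s) / (s * x) * (s / ((x - s) * x)) = (1 / x) ^ 2 by field_simp]
    exact Real.sqrt_sq (by positivity)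
  have d1 : HasDerivAt (fun s => δ * √(1 / s - 1 / x)) (δ * (-(s ^ 2)⁻¹ / (2 * √A))) s := by
    have h1 : HasDerivAt (fun s : ℝ => 1 / s - 1 / x) (-(s ^ 2)⁻¹) s := by
      simpa using (hasDerivAt_inv hs.ne').sub_const (1 / x)
    exact (h1.sqrt hA0.ne').const_mul δ
  -- The value of q is irrelevant, since it cancels between the two terms.
  obtain ⟨q, d2⟩ : ∃ q, HasDerivAt (fun s => y * √(1 / (x - s) - 1 / x)) q s := by
    have h1 : DifferentiableAt ℝ (fun s : ℝ => 1 / (x - s) - 1 / x) s := by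
      have := hxs.ne'
      fun_prop (disch := assumption)
    exact ⟨_, ((h1.hasDerivAt.sqrt hB0.ne').const_mul y)⟩
  have hcomb := (((hasDerivAt_normalTail _).comp s (d1.sub d2)).const_mul
    (mixKernel 0 x (y + δ))).add
    (((hasDerivAt_normalTail _).comp s (d1.add d2)).const_mul (mixKernel 0 x (y - δ)))
  refine HasDerivAt.congr_deriv (f := hittingPrimitive x y δ) hcomb ?_
  simp only [Pi.sub_apply, Pi.add_apply, ← hA, ← hB]
  set E := Real.exp (-δ ^ 2 / (2 * s)) * Real.exp (-y ^ 2 / (2 * (x - s))) with hE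
  have hsA : √A ^ 2 = A := Real.sq_sqrt hA0.le
  have hsB : √B ^ 2 = B := Real.sq_sqrt hB0.le
  -- Both signs at once, with e = ±1.
  have hcd : ∀ e : ℝ, e ^ 2 = 1 → mixKernel 0 x (y + e * δ)
      * Real.exp (-(δ * √A - e * (y * √B)) ^ 2 / 2) = (√(2 * Real.pi * x))⁻¹ * E := by
    intro e he
    rw [mixKernel, mul_assoc, ← Real.exp_add, hE, ← Real.exp_add]
    congr 2
    have h2 : (δ * √A - e * (y * √B)) ^ 2 = δ ^ 2 * A + y ^ 2 * B - 2 * e * δ * y * (1 / x) := by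
      rw [← hAB]
      linear_combination δ ^ 2 * hsA + y ^ 2 * hsB + y ^ 2 * √B ^ 2 * he
    have h3 : (y + e * δ - 0 * x) ^ 2 = y ^ 2 + δ ^ 2 + 2 * e * δ * y := by
      linear_combination δ ^ 2 * he
    rw [h2, h3, hA, hB]
    field_simp
    ring
  have hp := hcd 1 (by norm_num)
  have hm := hcd (-1) (by norm_num)
  simp only [one_mul, neg_mul, sub_neg_eq_add, ← sub_eq_add_neg] at hp hm
  set c := (√(2 * Real.pi))⁻¹
  have hfin : hittingDensity δ s * mixKernel 0 (x - s) y
      = c * ((√(2 * Real.pi * x))⁻¹ * E) * (δ * ((s ^ 2)⁻¹ / √A)) := by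
    have hsqA : √A = √(x - s) / (√s * √x) := by
      rw [hA', Real.sqrt_div hxs.le, Real.sqrt_mul hs.le]
    rw [hittingDensity, mixKernel, mixKernel, hsqA, hE]
    simp only [zero_mul, sub_zero, c]
    have h2pi : (0 : ℝ) ≤ 2 * Real.pi := by positivity
    rw [Real.sqrt_mul h2pi s, Real.sqrt_mul h2pi x, Real.sqrt_mul h2pi (x - s)]
    have hss : √s ^ 2 = s := Real.sq_sqrt hs.le
    have p1 : 0 < √s := Real.sqrt_pos.2 hs
    have p2 : 0 < √x := Real.sqrt_pos.2 hx
    have p3 : 0 < √(x - s) := Real.sqrt_pos.2 hxs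
    have p4 : 0 < √(2 * Real.pi) := by positivity
    field_simp
    rw [hss]
  rw [hfin]
  have hA2 : -(s ^ 2)⁻¹ / (2 * √A) = -((s ^ 2)⁻¹ / √A) / 2 := by ring
  rw [hA2]
  linear_combination (-c * (δ * (-((s ^ 2)⁻¹ / √A) / 2) - q)) * hp
    + (-c * (δ * (-((s ^ 2)⁻¹ / √A) / 2) + q)) * hm

lemma tendsto_sqrt_inv_sub_nhdsGT (x : ℝ) :
    Tendsto (fun s : ℝ => √(1 / s - 1 / x)) (𝓝[>] 0) atTop := by
  refine Real.tendsto_sqrt_atTop.comp ?_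
  simp only [one_div, sub_eq_add_neg]
  exact tendsto_atTop_add_const_right _ _ tendsto_inv_nhdsGT_zero

lemma tendsto_sqrt_inv_sub_self (hx : 0 < x) :
    Tendsto (fun s : ℝ => √(1 / s - 1 / x)) (𝓝 x) (𝓝 0) := by
  have h : ContinuousAt (fun s : ℝ => √(1 / s - 1 / x)) x := by
    have := hx.ne'
    fun_prop (disch := assumption)
  simpa using h.tendsto

lemma tendsto_const_sub_nhdsLT (x : ℝ) : Tendsto (fun s => x - s) (𝓝[<] x) (𝓝[>] 0) := by
  refine tendsto_nhdsWithin_iff.2 ⟨?_, ?_⟩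
  · have : Continuous fun s : ℝ => x - s := by fun_prop
    simpa using (this.tendsto x).mono_left (nhdsWithin_le_nhds (s := Iio x))
  · filter_upwards [self_mem_nhdsWithin] with s hs
    simpa using hs

lemma tendsto_hittingPrimitive_nhdsGT (hx : 0 < x) (hδ : 0 < δ) :
    Tendsto (hittingPrimitive x y δ) (𝓝[>] 0) (𝓝 0) := by
  have h1 : Tendsto (fun s => δ * √(1 / s - 1 / x)) (𝓝[>] 0) atTop :=
    (tendsto_sqrt_inv_sub_nhdsGT x).const_mul_atTop hδ
  have h2 : Tendsto (fun s => y * √(1 / (x - s) - 1 / x)) (𝓝[>] 0) (𝓝 0) := by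
    have h3 : Tendsto (fun s => x - s) (𝓝[>] 0) (𝓝 x) := by
      have : Continuous fun s : ℝ => x - s := by fun_prop
      simpa using (this.tendsto 0).mono_left (nhdsWithin_le_nhds (s := Ioi 0))
    simpa using ((tendsto_sqrt_inv_sub_self hx).comp h3).const_mul y
  have h4 := tendsto_normalTail_atTop.comp (h1.atTop_add h2.neg)
  have h5 := tendsto_normalTail_atTop.comp (h1.atTop_add h2)
  have h6 := (h4.const_mul (mixKernel 0 x (y + δ))).add (h5.const_mul (mixKernel 0 x (y - δ)))
  simp only [mul_zero, add_zero] at h6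
  exact h6

/-- As s increases to x, y > 0 sends the argument of the first tail to -∞ and that of the second to
+∞, so only the first term survives. -/
lemma tendsto_hittingPrimitive_nhdsLT (hx : 0 < x) (hy : 0 < y) :
    Tendsto (hittingPrimitive x y δ) (𝓝[<] x) (𝓝 (mixKernel 0 x (y + δ))) := by
  have h1 : Tendsto (fun s => δ * √(1 / s - 1 / x)) (𝓝[<] x) (𝓝 0) := by
    simpa using ((tendsto_sqrt_inv_sub_self hx).mono_left
      (nhdsWithin_le_nhds (s := Iio x))).const_mul δ
  have h2 : Tendsto (fun s => y * √(1 / (x - s) - 1 / x)) (𝓝[<] x) atTop :=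
    ((tendsto_sqrt_inv_sub_nhdsGT x).comp (tendsto_const_sub_nhdsLT x)).const_mul_atTop hy
  have h4 := tendsto_normalTail_atBot.comp
    (h1.add_atBot (tendsto_neg_atTop_atBot.comp h2))
  have h5 := tendsto_normalTail_atTop.comp (h1.add_atTop h2)
  have h6 := (h4.const_mul (mixKernel 0 x (y + δ))).add (h5.const_mul (mixKernel 0 x (y - δ)))
  simp only [mul_zero, mul_one, add_zero] at h6
  exact h6

/-- The strong Markov property of Brownian motion at a first passage time. -/
lemma lintegral_hittingDensity_mul_mixKernel (hx : 0 < x) (hy : 0 < y) (hδ : 0 < δ) :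
    ∫⁻ s in Ioo 0 x, ENNReal.ofReal (hittingDensity δ s * mixKernel 0 (x - s) y)
      = ENNReal.ofReal (mixKernel 0 x (y + δ)) := by
  have hint : IntegrableOn (fun s => hittingDensity δ s * mixKernel 0 (x - s) y) (Ioo 0 x) := by
    obtain ⟨C, hC⟩ := mixKernel_bounds 0 hδ
    obtain ⟨C', hC'⟩ := mixKernel_bounds 0 hy
    refine Measure.integrableOn_of_bounded (M := C * C') (by simp) ?_ ?_
    · refine Measurable.aestronglyMeasurable ?_
      have := measurable_hittingDensity δ
      fun_prop
    · filter_upwards [ae_restrict_mem measurableSet_Ioo] with s hs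
      have b1 := (hC δ ⟨by linarith, by linarith⟩ s hs.1).2
      have b2 := (hC' y ⟨by linarith, by linarith⟩ (x - s) (sub_pos.2 hs.2)).1
      rw [zero_sub, neg_mul, abs_neg] at b1
      rw [norm_mul, Real.norm_of_nonneg (mixKernel_nonneg 0 (x - s) y)]
      exact mul_le_mul b1 b2 (mixKernel_nonneg _ _ _) ((abs_nonneg _).trans b1)
  rw [← ofReal_integral_eq_lintegral_ofReal hint]
  · rw [← integral_Ioc_eq_integral_Ioo, ← intervalIntegral.integral_of_le hx.le,
      intervalIntegral.integral_eq_sub_of_hasDerivAt_of_tendsto hx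
        (fun s hs => hasDerivAt_hittingPrimitive hs.1 hs.2) ?_
        (tendsto_hittingPrimitive_nhdsGT hx hδ) (tendsto_hittingPrimitive_nhdsLT hx hy), sub_zero]
    rw [intervalIntegrable_iff_integrableOn_Ioo_of_le hx.le]
    exact hint
  · filter_upwards [ae_restrict_mem measurableSet_Ioo] with s hs
    exact mul_nonneg (hittingDensity_nonneg hδ.le hs.1.le) (mixKernel_nonneg _ _ _)

end Convolution

/-- The mean of `g` at the first passage time through the level `δ`, started at time `r`. -/
noncomputable def hittingAverage (g : ℝ → ℝ≥0∞) (δ r : ℝ) : ℝ≥0∞ :=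
  ∫⁻ s in Ioi (0 : ℝ), ENNReal.ofReal (hittingDensity δ s) * g (r + s)

lemma ae_eq_comp_add {g g' : ℝ → ℝ≥0∞} (h : g =ᵐ[volume] g') (r : ℝ) :
    (fun s => g (r + s)) =ᵐ[volume] fun s => g' (r + s) :=
  (measurePreserving_add_left volume r).quasiMeasurePreserving.ae_eq_comp h

lemma hittingAverage_congr_ae {g g' : ℝ → ℝ≥0∞} (h : g =ᵐ[volume] g') :
    hittingAverage g = hittingAverage g' := by
  ext δ r
  refine lintegral_congr_ae (ae_restrict_of_ae ?_)
  filter_upwards [ae_eq_comp_add h r] with s hs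
  rw [hs]

lemma stdMixture_congr_ae {g g' : ℝ → ℝ≥0∞} (β : ℝ) (h : g =ᵐ[volume] g') :
    stdMixture β g = stdMixture β g' := by
  ext y
  refine lintegral_congr_ae (ae_restrict_of_ae ?_)
  filter_upwards [h] with s hs
  rw [hs]

lemma measurable_hittingAverage {g : ℝ → ℝ≥0∞} (hg : AEMeasurable g volume) (δ : ℝ) :
    Measurable (hittingAverage g δ) := by
  rw [hittingAverage_congr_ae hg.ae_eq_mk]
  have h1 := measurable_hittingDensity δ
  have h2 := hg.measurable_mk
  unfold hittingAverage
  refine Measurable.lintegral_prod_right' (f := fun p : ℝ × ℝ =>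
    ENNReal.ofReal (hittingDensity δ p.2) * hg.mk g (p.1 + p.2)) ?_
  fun_prop

/-- Inserting the first-passage decomposition and substituting x = r + s separates the variables: y
enters only through the kernel and δ only through the average of g. This is what makes composition
of kernels applicable. -/
lemma stdMixture_add {g : ℝ → ℝ≥0∞} (hg : AEMeasurable g volume) {y δ : ℝ} (hy : 0 < y)
    (hδ : 0 < δ) : stdMixture 0 g (y + δ)
      = ∫⁻ r in Ioi (0 : ℝ), ENNReal.ofReal (mixKernel 0 r y) * hittingAverage g δ r := by
  wlog hgm : Measurable g generalizing g
  · rw [stdMixture_congr_ae 0 hg.ae_eq_mk, hittingAverage_congr_ae hg.ae_eq_mk]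
    exact this hg.measurable_mk.aemeasurable hg.measurable_mk
  set q : ℝ → ℝ≥0∞ := fun s => ENNReal.ofReal (hittingDensity δ s) with hq
  have hqm : Measurable q := (measurable_hittingDensity δ).ennreal_ofReal
  -- Extension by zero to r ≤ 0 encodes the constraint s < x in k(x - s).
  set k : ℝ → ℝ≥0∞ := (Ioi 0).indicator fun r => ENNReal.ofReal (mixKernel 0 r y) with hk
  have hkm : Measurable k := by
    refine Measurable.indicator ?_ measurableSet_Ioi
    fun_prop
  have h1 : ∀ x, (Ioi 0).indicator (fun x => ENNReal.ofReal (mixKernel 0 x (y + δ)) * g x) x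
      = ∫⁻ s in Ioi (0 : ℝ), q s * (k (x - s) * g x) := by
    intro x
    have h2 : ∫⁻ s in Ioi (0 : ℝ), q s * (k (x - s) * g x)
        = (∫⁻ s in Ioi (0 : ℝ), q s * k (x - s)) * g x := by
      rw [← lintegral_mul_const _ (by fun_prop)]
      simp only [mul_assoc]
    rw [h2]
    rcases le_or_gt x 0 with hx | hx
    · rw [indicator_of_notMem (by simpa using hx), eq_comm, mul_eq_zero]
      left
      rw [← lintegral_zero]
      refine setLIntegral_congr_fun measurableSet_Ioi fun s (hs : 0 < s) => ?_
      have : x - s ∉ Ioi (0 : ℝ) := by simp only [mem_Ioi, not_lt]; linarith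
      simp [hk, this]
    · rw [indicator_of_mem (by simpa using hx),
        ← lintegral_hittingDensity_mul_mixKernel hx hy hδ]
      congr 1
      rw [← Ioi_inter_Iio, inter_comm, ← setLIntegral_indicator measurableSet_Iio]
      refine setLIntegral_congr_fun measurableSet_Ioi fun s (hs : 0 < s) => ?_
      by_cases hsx : s < x
      · rw [indicator_of_mem (by simpa using hsx),
          ENNReal.ofReal_mul (hittingDensity_nonneg hδ.le hs.le), hk,
          indicator_of_mem (by simpa using hsx)]
      · rw [indicator_of_notMem (by simpa using hsx), hk,
          indicator_of_notMem (by simpa using hsx), mul_zero]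
  calc stdMixture 0 g (y + δ)
      = ∫⁻ x, ∫⁻ s in Ioi (0 : ℝ), q s * (k (x - s) * g x) := by
        rw [stdMixture, ← lintegral_indicator measurableSet_Ioi]
        exact lintegral_congr h1
    _ = ∫⁻ s in Ioi (0 : ℝ), ∫⁻ x, q s * (k (x - s) * g x) :=
        lintegral_lintegral_swap (by fun_prop)
    _ = ∫⁻ s in Ioi (0 : ℝ), ∫⁻ r in Ioi (0 : ℝ),
          q s * (ENNReal.ofReal (mixKernel 0 r y) * g (r + s)) := by
        refine lintegral_congr fun s => ?_
        rw [← lintegral_indicator measurableSet_Ioi,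
          ← lintegral_sub_right_eq_self (fun r => (Ioi (0 : ℝ)).indicator _ r) s]
        refine lintegral_congr fun x => ?_
        by_cases hx : x - s ∈ Ioi (0 : ℝ) <;> simp [hk, hx]
    _ = ∫⁻ r in Ioi (0 : ℝ), ∫⁻ s in Ioi (0 : ℝ),
          q s * (ENNReal.ofReal (mixKernel 0 r y) * g (r + s)) :=
        lintegral_lintegral_swap (by fun_prop)
    _ = _ := by
        refine lintegral_congr fun r => ?_
        rw [hittingAverage, ← lintegral_const_mul' _ _ ENNReal.ofReal_ne_top]
        refine lintegral_congr fun s => ?_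
        ring

/-- This is (p - q)(s - r) ≥ 0 without subtraction. -/
lemma ENNReal.mul_add_mul_le_of_le {p q r s : ℝ≥0∞} (hqp : q ≤ p) (hrs : r ≤ s) :
    p * r + q * s ≤ p * s + q * r := by
  obtain ⟨a, rfl⟩ := exists_add_of_le hqp
  obtain ⟨b, rfl⟩ := exists_add_of_le hrs
  calc _ ≤ (q + a) * r + q * (r + b) + a * b := le_self_add
    _ = _ := by ring

/-- The basic composition inequality for kernels that are totally positive, respectively reverse
regular, of order two. -/
lemma lintegral_mul_lintegral_le_of_composition {L₁ L₂ M₁ M₂ : ℝ → ℝ≥0∞} {S : Set ℝ}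
    (hS : MeasurableSet S)
    (hL₁ : AEMeasurable L₁ (volume.restrict S)) (hL₂ : AEMeasurable L₂ (volume.restrict S))
    (hM₁ : AEMeasurable M₁ (volume.restrict S)) (hM₂ : AEMeasurable M₂ (volume.restrict S))
    (hL : ∀ x ∈ S, ∀ z ∈ S, x ≤ z → L₁ z * L₂ x ≤ L₁ x * L₂ z)
    (hM : ∀ x ∈ S, ∀ z ∈ S, x ≤ z → M₁ x * M₂ z ≤ M₁ z * M₂ x) :
    (∫⁻ x in S, L₁ x * M₁ x) * (∫⁻ x in S, L₂ x * M₂ x)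
      ≤ (∫⁻ x in S, L₁ x * M₂ x) * (∫⁻ x in S, L₂ x * M₁ x) := by
  set ν := volume.restrict S
  have e1 := lintegral_prod_mul (hL₁.mul hM₁) (hL₂.mul hM₂)
  have e2 := lintegral_prod_mul (hL₂.mul hM₂) (hL₁.mul hM₁)
  have e3 := lintegral_prod_mul (hL₁.mul hM₂) (hL₂.mul hM₁)
  have e4 := lintegral_prod_mul (hL₂.mul hM₁) (hL₁.mul hM₂)
  simp only [Pi.mul_apply] at e1 e2 e3 e4
  -- Both sides are symmetrised under exchange of the two variables. Pointwise, the difference of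
  -- the integrands is then a product of two differences that have the same sign in either order of
  -- the variables.
  have key : ∫⁻ z, (L₁ z.1 * M₁ z.1 * (L₂ z.2 * M₂ z.2) + L₂ z.1 * M₂ z.1 * (L₁ z.2 * M₁ z.2))
        ∂(ν.prod ν)
      ≤ ∫⁻ z, (L₁ z.1 * M₂ z.1 * (L₂ z.2 * M₁ z.2) + L₂ z.1 * M₁ z.1 * (L₁ z.2 * M₂ z.2))
        ∂(ν.prod ν) := by
    rw [Measure.prod_restrict]
    refine setLIntegral_mono' (hS.prod hS) fun z hz => ?_
    obtain ⟨h1, h2⟩ := hz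
    rcases le_total z.1 z.2 with h | h
    · convert ENNReal.mul_add_mul_le_of_le (hL _ h1 _ h2 h) (hM _ h1 _ h2 h) using 1 <;> ring
    · convert ENNReal.mul_add_mul_le_of_le (hL _ h2 _ h1 h) (hM _ h2 _ h1 h) using 1 <;> ring
  rw [lintegral_add_left' (by fun_prop), lintegral_add_left' (by fun_prop), e1, e2, e3, e4,
    mul_comm (∫⁻ x in S, L₂ x * M₂ x), mul_comm (∫⁻ x in S, L₂ x * M₁ x), ← two_mul, ← two_mul]
    at key
  exact (ENNReal.mul_le_mul_iff_right two_ne_zero ENNReal.ofNat_ne_top).1 key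

/-! ### Four-point inequalities for the driftless mixture -/

section TotalPositivity

variable {g : ℝ → ℝ≥0∞} {y z δ ε : ℝ}

lemma aemeasurable_comp_add (hg : AEMeasurable g volume) (r : ℝ) :
    AEMeasurable (fun s => g (r + s)) (volume.restrict (Ioi 0)) :=
  (hg.comp_quasiMeasurePreserving
    (measurePreserving_add_left volume r).quasiMeasurePreserving).restrict

lemma ofReal_hittingDensity_mul_le (hδ : 0 ≤ δ) (hδε : δ ≤ ε) :
    ∀ s ∈ Ioi (0 : ℝ), ∀ t ∈ Ioi (0 : ℝ), s ≤ t →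
      ENNReal.ofReal (hittingDensity δ t) * ENNReal.ofReal (hittingDensity ε s)
        ≤ ENNReal.ofReal (hittingDensity δ s) * ENNReal.ofReal (hittingDensity ε t) := by
  intro s (hs : 0 < s) t (ht : 0 < t) hst
  rw [← ENNReal.ofReal_mul (hittingDensity_nonneg hδ ht.le),
    ← ENNReal.ofReal_mul (hittingDensity_nonneg hδ hs.le)]
  exact ENNReal.ofReal_le_ofReal (hittingDensity_mul_le hs hst hδ hδε)

lemma ofReal_mixKernel_mul_le (hy : 0 ≤ y) (hyz : y ≤ z) :
    ∀ s ∈ Ioi (0 : ℝ), ∀ t ∈ Ioi (0 : ℝ), s ≤ t →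
      ENNReal.ofReal (mixKernel 0 t y) * ENNReal.ofReal (mixKernel 0 s z)
        ≤ ENNReal.ofReal (mixKernel 0 s y) * ENNReal.ofReal (mixKernel 0 t z) := by
  intro s (hs : 0 < s) t (ht : 0 < t) hst
  rw [← ENNReal.ofReal_mul (mixKernel_nonneg _ _ _), ← ENNReal.ofReal_mul (mixKernel_nonneg _ _ _)]
  refine ENNReal.ofReal_le_ofReal ?_
  linarith [mixKernel_zero_mul_le hs hst hy hyz]

/-- Two compositions. The inner one, over the passage time, combines the hitting density with g(r +
s) and shows that the average of g is reverse regular in (r, δ); the outer one, over r, combines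
this with the kernel. -/
lemma stdMixture_mul_le_of_logConcave (hg : AEMeasurable g volume)
    (h : ∀ x > 0, ∀ u ≥ 0, ∀ v ≥ 0, g x * g (x + u + v) ≤ g (x + u) * g (x + v))
    (hy : 0 < y) (hyz : y ≤ z) (hδ : 0 < δ) (hδε : δ ≤ ε) :
    stdMixture 0 g (y + δ) * stdMixture 0 g (z + ε)
      ≤ stdMixture 0 g (y + ε) * stdMixture 0 g (z + δ) := by
  have hε := hδ.trans_le hδε
  have hz := hy.trans_le hyz
  have hq := fun δ => (measurable_hittingDensity δ).ennreal_ofReal.aemeasurable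
    (μ := volume.restrict (Ioi 0))
  have hA := fun δ => (measurable_hittingAverage hg δ).aemeasurable (μ := volume.restrict (Ioi 0))
  rw [stdMixture_add hg hy hδ, stdMixture_add hg hz hε, stdMixture_add hg hy hε,
    stdMixture_add hg hz hδ]
  refine lintegral_mul_lintegral_le_of_composition measurableSet_Ioi (by fun_prop) (by fun_prop)
    (hA δ) (hA ε) (ofReal_mixKernel_mul_le hy.le hyz) fun p (hp : 0 < p) q _ hpq => ?_
  rw [mul_comm (hittingAverage g δ q), mul_comm (hittingAverage g ε p)]
  refine lintegral_mul_lintegral_le_of_composition measurableSet_Ioi (hq δ) (hq ε)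
    (aemeasurable_comp_add hg p) (aemeasurable_comp_add hg q)
    (ofReal_hittingDensity_mul_le hδ.le hδε) fun s (hs : 0 < s) t _ hst => ?_
  convert h (p + s) (by positivity) (t - s) (sub_nonneg.2 hst) (q - p) (sub_nonneg.2 hpq) using 3
    <;> ring

lemma stdMixture_mul_le_of_logConvex (hg : AEMeasurable g volume)
    (h : ∀ x > 0, ∀ u ≥ 0, ∀ v ≥ 0, g (x + u) * g (x + v) ≤ g x * g (x + u + v))
    (hy : 0 < y) (hyz : y ≤ z) (hδ : 0 < δ) (hδε : δ ≤ ε) :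
    stdMixture 0 g (y + ε) * stdMixture 0 g (z + δ)
      ≤ stdMixture 0 g (y + δ) * stdMixture 0 g (z + ε) := by
  have hε := hδ.trans_le hδε
  have hz := hy.trans_le hyz
  have hq := fun δ => (measurable_hittingDensity δ).ennreal_ofReal.aemeasurable
    (μ := volume.restrict (Ioi 0))
  have hA := fun δ => (measurable_hittingAverage hg δ).aemeasurable (μ := volume.restrict (Ioi 0))
  rw [stdMixture_add hg hy hδ, stdMixture_add hg hz hε, stdMixture_add hg hy hε,
    stdMixture_add hg hz hδ]
  refine lintegral_mul_lintegral_le_of_composition measurableSet_Ioi (by fun_prop) (by fun_prop)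
    (hA ε) (hA δ) (ofReal_mixKernel_mul_le hy.le hyz) fun p (hp : 0 < p) q _ hpq => ?_
  rw [mul_comm (hittingAverage g ε p), mul_comm (hittingAverage g ε q)]
  refine lintegral_mul_lintegral_le_of_composition measurableSet_Ioi (hq δ) (hq ε)
    (aemeasurable_comp_add hg q) (aemeasurable_comp_add hg p)
    (ofReal_hittingDensity_mul_le hδ.le hδε) fun s (hs : 0 < s) t _ hst => ?_
  rw [mul_comm (g (q + t))]
  convert h (p + s) (by positivity) (q - p) (sub_nonneg.2 hpq) (t - s) (sub_nonneg.2 hst) using 3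
    <;> ring

end TotalPositivity

/-! ### Four-point forms of log-concavity and log-convexity -/

section FourPoint

variable {g : ℝ → ℝ≥0∞} {x u v : ℝ}

lemma exists_weight_of_add (hu : 0 < u) (hv : 0 < v) (x : ℝ) :
    ∃ θ ∈ Ioo (0 : ℝ) 1, x + u = θ * x + (1 - θ) * (x + u + v) ∧
      x + v = (1 - θ) * x + θ * (x + u + v) := by
  refine ⟨v / (u + v), ⟨by positivity, by rw [div_lt_one (by positivity)]; linarith⟩, ?_, ?_⟩
  · field_simp; ring
  · field_simp; ring

/-- The inner points are convex combinations of the outer ones with complementary weights, so the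
exponents add up to 1 when the two inequalities are multiplied. -/
lemma LogConcaveOn.mul_le (h : LogConcaveOn (Ioi 0) g) (hx : 0 < x) (hu : 0 ≤ u) (hv : 0 ≤ v) :
    g x * g (x + u + v) ≤ g (x + u) * g (x + v) := by
  rcases hu.eq_or_lt with rfl | hu
  · simp
  rcases hv.eq_or_lt with rfl | hv
  · simp [mul_comm]
  obtain ⟨θ, hθ, h1, h2⟩ := exists_weight_of_add hu hv x
  have hxuv : x + u + v ∈ Ioi (0 : ℝ) := by simp only [mem_Ioi]; positivity
  have a1 := h.2 x hx _ hxuv θ hθ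
  have a2 := h.2 x hx _ hxuv (1 - θ) ⟨by linarith [hθ.2], by linarith [hθ.1]⟩
  rw [sub_sub_cancel] at a2
  rw [← h1] at a1
  rw [← h2] at a2
  have hsum : ∀ a : ℝ≥0∞, a ^ θ * a ^ (1 - θ) = a := by
    intro a
    rw [← ENNReal.rpow_add_of_nonneg _ _ hθ.1.le (by linarith [hθ.2])]
    simp
  calc g x * g (x + u + v)
      = (g x ^ θ * g x ^ (1 - θ)) * (g (x + u + v) ^ θ * g (x + u + v) ^ (1 - θ)) := by
        rw [hsum, hsum]
    _ = (g x ^ θ * g (x + u + v) ^ (1 - θ)) * (g x ^ (1 - θ) * g (x + u + v) ^ θ) := by ring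
    _ ≤ _ := mul_le_mul' a1 a2

lemma LogConvexOn.mul_le (h : LogConvexOn (Ioi 0) g) (hx : 0 < x) (hu : 0 ≤ u) (hv : 0 ≤ v) :
    g (x + u) * g (x + v) ≤ g x * g (x + u + v) := by
  rcases hu.eq_or_lt with rfl | hu
  · simp
  rcases hv.eq_or_lt with rfl | hv
  · simp [mul_comm]
  obtain ⟨θ, hθ, h1, h2⟩ := exists_weight_of_add hu hv x
  have hxuv : x + u + v ∈ Ioi (0 : ℝ) := by simp only [mem_Ioi]; positivity
  have a1 := h.2.2 hx hxuv hθ.1.le (by linarith [hθ.2] : 0 ≤ 1 - θ) (by ring)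
  have a2 := h.2.2 hx hxuv (by linarith [hθ.2] : 0 ≤ 1 - θ) hθ.1.le (by ring)
  simp only [smul_eq_mul] at a1 a2
  rw [← h1] at a1
  rw [← h2] at a2
  have hexp : ∀ a > 0, g a = ENNReal.ofReal (Real.exp (Real.log (g a).toReal)) := by
    intro a ha
    obtain ⟨b1, b2⟩ := h.1 a ha
    rw [Real.exp_log (ENNReal.toReal_pos b1.ne' b2.ne), ENNReal.ofReal_toReal b2.ne]
  rw [hexp (x + u) (by positivity), hexp (x + v) (by positivity), hexp x hx,
    hexp (x + u + v) hxuv, ← ENNReal.ofReal_mul (Real.exp_pos _).le,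
    ← ENNReal.ofReal_mul (Real.exp_pos _).le, ← Real.exp_add, ← Real.exp_add]
  refine ENNReal.ofReal_le_ofReal (Real.exp_le_exp.2 ?_)
  linarith

lemma tilt_mul_tilt (β : ℝ) (g : ℝ → ℝ≥0∞) (a b : ℝ) :
    tilt β g a * tilt β g b
      = ENNReal.ofReal (Real.exp (-β ^ 2 / 2 * (a + b))) * (g a * g b) := by
  rw [mul_add, Real.exp_add, ENNReal.ofReal_mul (Real.exp_pos _).le, tilt, tilt]
  ring

/-- The tilting factor is the exponential of a linear function, so only the sum of the arguments
counts. -/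
lemma tilt_mul_le_tilt_mul {β a b c d : ℝ} (h : g a * g d ≤ g b * g c) (hs : a + d = b + c) :
    tilt β g a * tilt β g d ≤ tilt β g b * tilt β g c := by
  rw [tilt_mul_tilt, tilt_mul_tilt, hs]
  gcongr

end FourPoint

/-! ### Log-concavity and log-convexity of the mixture -/

section LogMixture

variable {g : ℝ → ℝ≥0∞}

lemma lintegral_tilt_ne_top (β : ℝ) (hfin : ∫⁻ x in Ioi (0 : ℝ), g x ≠ ∞) :
    ∫⁻ x in Ioi (0 : ℝ), tilt β g x ≠ ∞ := by
  refine ne_top_of_le_ne_top hfin (setLIntegral_mono' measurableSet_Ioi fun x (hx : 0 < x) => ?_)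
  refine mul_le_of_le_one_left' ?_
  rw [ENNReal.ofReal_le_one, Real.exp_le_one_iff]
  nlinarith [mul_nonneg (sq_nonneg β) hx.le]

lemma lintegral_tilt_ne_zero (β : ℝ) (hg : AEMeasurable g volume)
    (hpos : ∫⁻ x in Ioi (0 : ℝ), g x ≠ 0) : ∫⁻ x in Ioi (0 : ℝ), tilt β g x ≠ 0 := by
  intro h
  apply hpos
  rw [lintegral_eq_zero_iff' (aemeasurable_tilt β hg).restrict] at h
  rw [lintegral_eq_zero_iff' hg.restrict]
  filter_upwards [h] with x hx
  simpa [tilt, (Real.exp_pos _).not_ge] using hx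

/-- The logarithm of the driftless mixture. -/
noncomputable def logStdMixture (g : ℝ → ℝ≥0∞) (y : ℝ) : ℝ := Real.log (stdMixture 0 g y).toReal

lemma differentiableAt_logStdMixture (hg : AEMeasurable g volume)
    (hfin : ∫⁻ x in Ioi (0 : ℝ), g x ≠ ∞) (hpos : ∫⁻ x in Ioi (0 : ℝ), g x ≠ 0) {y : ℝ}
    (hy : 0 < y) : DifferentiableAt ℝ (logStdMixture g) y :=
  (hasDerivAt_stdMixture 0 hg hfin hy).differentiableAt.log
    (ENNReal.toReal_pos (stdMixture_pos 0 hg hpos y).ne' (stdMixture_lt_top 0 hfin hy).ne).ne'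

lemma logStdMixture_add_le (hg : AEMeasurable g volume)
    (hfin : ∫⁻ x in Ioi (0 : ℝ), g x ≠ ∞) (hpos : ∫⁻ x in Ioi (0 : ℝ), g x ≠ 0) {a b c d : ℝ}
    (ha : 0 < a) (hb : 0 < b) (hc : 0 < c) (hd : 0 < d)
    (h : stdMixture 0 g a * stdMixture 0 g d ≤ stdMixture 0 g b * stdMixture 0 g c) :
    logStdMixture g a + logStdMixture g d ≤ logStdMixture g b + logStdMixture g c := by
  have hne := fun y (hy : 0 < y) => (stdMixture_lt_top 0 hfin hy).ne
  have h0 := fun y (hy : 0 < y) =>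
    ENNReal.toReal_pos (stdMixture_pos 0 hg hpos y).ne' (hne y hy)
  unfold logStdMixture
  rw [← Real.log_mul (h0 a ha).ne' (h0 d hd).ne', ← Real.log_mul (h0 b hb).ne' (h0 c hc).ne',
    ← ENNReal.toReal_mul, ← ENNReal.toReal_mul]
  refine Real.log_le_log ?_ (ENNReal.toReal_mono (ENNReal.mul_ne_top (hne b hb) (hne c hc)) h)
  rw [ENNReal.toReal_mul]
  exact mul_pos (h0 a ha) (h0 d hd)

lemma deriv_le_deriv_of_increment_le {f : ℝ → ℝ} {a c : ℝ} (ha : DifferentiableAt ℝ f a)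
    (hc : DifferentiableAt ℝ f c) (h : ∀ t > 0, f (a + t) - f a ≤ f (c + t) - f c) :
    deriv f a ≤ deriv f c := by
  refine le_of_tendsto_of_tendsto ha.hasDerivAt.tendsto_slope_zero_right
    hc.hasDerivAt.tendsto_slope_zero_right ?_
  filter_upwards [self_mem_nhdsWithin] with t (ht : 0 < t)
  simp only [smul_eq_mul]
  exact mul_le_mul_of_nonneg_left (h t ht) (inv_nonneg.2 ht.le)

lemma deriv_logStdMixture_antitoneOn (hg : AEMeasurable g volume)
    (hfin : ∫⁻ x in Ioi (0 : ℝ), g x ≠ ∞) (hpos : ∫⁻ x in Ioi (0 : ℝ), g x ≠ 0)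
    (h : ∀ x > 0, ∀ u ≥ 0, ∀ v ≥ 0, g x * g (x + u + v) ≤ g (x + u) * g (x + v)) :
    AntitoneOn (deriv (logStdMixture g)) (Ioi 0) := by
  intro a ha c hc hac
  simp only [mem_Ioi] at ha hc
  refine deriv_le_deriv_of_increment_le (differentiableAt_logStdMixture hg hfin hpos hc)
    (differentiableAt_logStdMixture hg hfin hpos ha) fun t ht => ?_
  -- All four parameters are positive, and their sums are a, c + t, a + t and c; the inequality
  -- compares the increments of log f over a step t at a and at c.
  have key := stdMixture_mul_le_of_logConcave hg h (y := a / 2) (z := c - a / 2) (δ := a / 2)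
    (ε := a / 2 + t) (by linarith) (by linarith) (by linarith) (by linarith)
  rw [show a / 2 + a / 2 = a by ring, show c - a / 2 + (a / 2 + t) = c + t by ring,
    show a / 2 + (a / 2 + t) = a + t by ring, show c - a / 2 + a / 2 = c by ring] at key
  linarith [logStdMixture_add_le hg hfin hpos ha (by linarith) hc (by linarith) key]

lemma deriv_logStdMixture_monotoneOn (hg : AEMeasurable g volume)
    (hfin : ∫⁻ x in Ioi (0 : ℝ), g x ≠ ∞) (hpos : ∫⁻ x in Ioi (0 : ℝ), g x ≠ 0)
    (h : ∀ x > 0, ∀ u ≥ 0, ∀ v ≥ 0, g (x + u) * g (x + v) ≤ g x * g (x + u + v)) :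
    MonotoneOn (deriv (logStdMixture g)) (Ioi 0) := by
  intro a ha c hc hac
  simp only [mem_Ioi] at ha hc
  refine deriv_le_deriv_of_increment_le (differentiableAt_logStdMixture hg hfin hpos ha)
    (differentiableAt_logStdMixture hg hfin hpos hc) fun t ht => ?_
  have key := stdMixture_mul_le_of_logConvex hg h (y := a / 2) (z := c - a / 2) (δ := a / 2)
    (ε := a / 2 + t) (by linarith) (by linarith) (by linarith) (by linarith)
  rw [show a / 2 + a / 2 = a by ring, show c - a / 2 + (a / 2 + t) = c + t by ring,
    show a / 2 + (a / 2 + t) = a + t by ring, show c - a / 2 + a / 2 = c by ring] at key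
  linarith [logStdMixture_add_le hg hfin hpos (by linarith : 0 < a + t) ha (by linarith) hc key]

/-- Log-concavity excludes a pole: f(a) f(2) ≤ f(a + 1) f(1) ≤ f(1)² for 0 < a < 1, and a tends to
0. -/
lemma stdMixture_zero_zero_lt_top (hg : AEMeasurable g volume)
    (hfin : ∫⁻ x in Ioi (0 : ℝ), g x ≠ ∞) (hpos : ∫⁻ x in Ioi (0 : ℝ), g x ≠ 0)
    (h : ∀ x > 0, ∀ u ≥ 0, ∀ v ≥ 0, g x * g (x + u + v) ≤ g (x + u) * g (x + v)) :
    stdMixture 0 g 0 < ∞ := by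
  have h2 : stdMixture 0 g 2 ≠ 0 := (stdMixture_pos 0 hg hpos 2).ne'
  have hlt := fun y (hy : (0 : ℝ) < y) => stdMixture_lt_top 0 hfin hy
  have hb : stdMixture 0 g 0 ≤ stdMixture 0 g 1 * stdMixture 0 g 1 / stdMixture 0 g 2 := by
    refine le_of_tendsto (tendsto_stdMixture_nhdsGT 0 hg) ?_
    filter_upwards [Ioo_mem_nhdsGT one_pos] with a ha
    obtain ⟨ha0, ha1⟩ := ha
    rw [ENNReal.le_div_iff_mul_le (Or.inl h2) (Or.inl (hlt 2 two_pos).ne)]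
    have key := stdMixture_mul_le_of_logConcave hg h (y := a / 2) (z := 1 - a / 2) (δ := a / 2)
      (ε := a / 2 + 1) (by linarith) (by linarith) (by linarith) (by linarith)
    rw [show a / 2 + a / 2 = a by ring, show 1 - a / 2 + (a / 2 + 1) = 2 by ring,
      show a / 2 + (a / 2 + 1) = a + 1 by ring, show 1 - a / 2 + a / 2 = 1 by ring] at key
    refine key.trans ?_
    gcongr
    exact stdMixture_zero_antitoneOn g (by simp) (by simp; linarith) (by linarith)
  exact hb.trans_lt (ENNReal.div_lt_top (ENNReal.mul_lt_top (hlt 1 one_pos) (hlt 1 one_pos)).ne h2)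

lemma concaveOn_logStdMixture (hg : AEMeasurable g volume)
    (hfin : ∫⁻ x in Ioi (0 : ℝ), g x ≠ ∞) (hpos : ∫⁻ x in Ioi (0 : ℝ), g x ≠ 0)
    (h : ∀ x > 0, ∀ u ≥ 0, ∀ v ≥ 0, g x * g (x + u + v) ≤ g (x + u) * g (x + v)) :
    ConcaveOn ℝ (Ici 0) (logStdMixture g) := by
  have h0 := stdMixture_zero_zero_lt_top hg hfin hpos h
  refine AntitoneOn.concaveOn_of_deriv (convex_Ici 0) ?_ ?_ ?_
  · intro y hy
    rcases (mem_Ici.1 hy).eq_or_lt with rfl | hy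
    · rw [← continuousWithinAt_Ioi_iff_Ici]
      exact ((ENNReal.tendsto_toReal h0.ne).comp (tendsto_stdMixture_nhdsGT 0 hg)).log
        (ENNReal.toReal_pos (stdMixture_pos 0 hg hpos 0).ne' h0.ne).ne'
    · exact (differentiableAt_logStdMixture hg hfin hpos hy).continuousAt.continuousWithinAt
  · rw [interior_Ici]
    exact fun y hy =>
      (differentiableAt_logStdMixture hg hfin hpos hy).differentiableWithinAt
  · rw [interior_Ici]
    exact deriv_logStdMixture_antitoneOn hg hfin hpos h

lemma convexOn_logStdMixture (hg : AEMeasurable g volume)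
    (hfin : ∫⁻ x in Ioi (0 : ℝ), g x ≠ ∞) (hpos : ∫⁻ x in Ioi (0 : ℝ), g x ≠ 0)
    (h : ∀ x > 0, ∀ u ≥ 0, ∀ v ≥ 0, g (x + u) * g (x + v) ≤ g x * g (x + u + v)) :
    ConvexOn ℝ (Ioi 0) (logStdMixture g) := by
  refine MonotoneOn.convexOn_of_deriv (convex_Ioi 0) (fun y hy =>
    (differentiableAt_logStdMixture hg hfin hpos hy).continuousAt.continuousWithinAt) ?_ ?_
  · rw [interior_Ioi]
    exact fun y hy =>
      (differentiableAt_logStdMixture hg hfin hpos hy).differentiableWithinAt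
  · rw [interior_Ioi]
    exact deriv_logStdMixture_monotoneOn hg hfin hpos h

lemma stdMixture_zero_abs (g : ℝ → ℝ≥0∞) (y : ℝ) : stdMixture 0 g |y| = stdMixture 0 g y := by
  rcases abs_choice y with h | h
  · rw [h]
  · rw [h, stdMixture_neg, neg_zero]

lemma log_stdMixture_eq (β : ℝ) (hg : AEMeasurable g volume)
    (hpos : ∫⁻ x in Ioi (0 : ℝ), g x ≠ 0) {y : ℝ} (hy : stdMixture 0 (tilt β g) y < ∞) :
    Real.log (stdMixture β g y).toReal = β * y + logStdMixture (tilt β g) y := by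
  rw [stdMixture_eq_exp_mul, ENNReal.toReal_mul, ENNReal.toReal_ofReal (Real.exp_pos _).le,
    Real.log_mul (Real.exp_pos _).ne', Real.log_exp, logStdMixture]
  exact (ENNReal.toReal_pos (stdMixture_pos 0 (aemeasurable_tilt β hg)
    (lintegral_tilt_ne_zero β hg hpos) y).ne' hy.ne).ne'

lemma logConcaveOn_of_concaveOn_log {f : ℝ → ℝ≥0∞} {I : Set ℝ} (h0 : ∀ x ∈ I, 0 < f x ∧ f x < ∞)
    (h : ConcaveOn ℝ I fun x => Real.log (f x).toReal) : LogConcaveOn I f := by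
  refine ⟨fun x hx => (h0 x hx).2, fun x hx y hy θ hθ => ?_⟩
  have hθ1 : 0 < 1 - θ := by linarith [hθ.2]
  have hz : θ * x + (1 - θ) * y ∈ I := h.1 hx hy hθ.1.le hθ1.le (by ring)
  have key := h.2 hx hy hθ.1.le hθ1.le (by ring)
  simp only [smul_eq_mul] at key
  have hexp : ∀ a ∈ I, f a = ENNReal.ofReal (Real.exp (Real.log (f a).toReal)) := by
    intro a ha
    obtain ⟨b1, b2⟩ := h0 a ha
    rw [Real.exp_log (ENNReal.toReal_pos b1.ne' b2.ne), ENNReal.ofReal_toReal b2.ne]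
  rw [hexp x hx, hexp y hy, hexp _ hz, ENNReal.ofReal_rpow_of_pos (Real.exp_pos _),
    ENNReal.ofReal_rpow_of_pos (Real.exp_pos _), ← Real.exp_mul, ← Real.exp_mul,
    ← ENNReal.ofReal_mul (Real.exp_pos _).le, ← Real.exp_add]
  refine ENNReal.ofReal_le_ofReal (Real.exp_le_exp.2 ?_)
  linarith

theorem stdMixture_lt_top_and_concaveOn_log (β : ℝ) (hg : AEMeasurable g volume)
    (hfin : ∫⁻ x in Ioi (0 : ℝ), g x ≠ ∞) (hpos : ∫⁻ x in Ioi (0 : ℝ), g x ≠ 0)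
    (h : LogConcaveOn (Ioi 0) g) :
    (∀ y, stdMixture β g y < ∞) ∧
      ConcaveOn ℝ univ fun y => Real.log (stdMixture β g y).toReal := by
  have hgm := aemeasurable_tilt β hg
  have hf := lintegral_tilt_ne_top β hfin
  have hp := lintegral_tilt_ne_zero β hg hpos
  have h4 : ∀ x > 0, ∀ u ≥ 0, ∀ v ≥ 0,
      tilt β g x * tilt β g (x + u + v) ≤ tilt β g (x + u) * tilt β g (x + v) :=
    fun x hx u hu v hv => tilt_mul_le_tilt_mul (h.mul_le hx hu hv) (by ring)
  have h0 := stdMixture_zero_zero_lt_top hgm hf hp h4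
  have hlt : ∀ y, stdMixture 0 (tilt β g) y < ∞ := by
    intro y
    rw [← stdMixture_zero_abs]
    exact (stdMixture_zero_antitoneOn _ (by simp) (by simp) (abs_nonneg y)).trans_lt h0
  refine ⟨fun y => ?_, ?_⟩
  · rw [stdMixture_eq_exp_mul]
    exact ENNReal.mul_lt_top ENNReal.ofReal_lt_top (hlt y)
  have himg : (fun y : ℝ => |y|) '' univ = Ici 0 := by
    ext y
    simp only [image_univ, mem_range, mem_Ici]
    exact ⟨fun ⟨z, hz⟩ => hz ▸ abs_nonneg z, fun hy => ⟨y, abs_of_nonneg hy⟩⟩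
  have hanti : AntitoneOn (logStdMixture (tilt β g)) (Ici 0) := by
    intro y hy z hz hyz
    exact Real.log_le_log (ENNReal.toReal_pos (stdMixture_pos 0 hgm hp z).ne' (hlt z).ne)
      (ENNReal.toReal_mono (hlt y).ne (stdMixture_zero_antitoneOn _ hy hz hyz))
  -- The driftless mixture is even, and a decreasing concave function of the convex function |y| is
  -- concave.
  have hcomp : ConcaveOn ℝ univ (logStdMixture (tilt β g) ∘ fun y => |y|) := by
    refine ConcaveOn.comp_convexOn ?_ (convexOn_univ_norm (E := ℝ)) ?_
    · rw [himg]; exact concaveOn_logStdMixture hgm hf hp h4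
    · rwa [himg]
  have hlin : ConcaveOn ℝ univ fun y : ℝ => β * y :=
    ((LinearMap.mul ℝ ℝ) β).concaveOn convex_univ
  refine (hlin.add hcomp).congr fun y _ => ?_
  rw [log_stdMixture_eq β hg hpos (hlt y)]
  simp [logStdMixture, stdMixture_zero_abs]

theorem convexOn_log_stdMixture (β : ℝ) (hg : AEMeasurable g volume)
    (hfin : ∫⁻ x in Ioi (0 : ℝ), g x ≠ ∞) (hpos : ∫⁻ x in Ioi (0 : ℝ), g x ≠ 0)
    (h : LogConvexOn (Ioi 0) g) :
    ConvexOn ℝ (Ioi 0) fun y => Real.log (stdMixture β g y).toReal := by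
  have hf := lintegral_tilt_ne_top β hfin
  have h4 : ∀ x > 0, ∀ u ≥ 0, ∀ v ≥ 0,
      tilt β g (x + u) * tilt β g (x + v) ≤ tilt β g x * tilt β g (x + u + v) :=
    fun x hx u hu v hv => tilt_mul_le_tilt_mul (h.mul_le hx hu hv) (by ring)
  have hlin : ConvexOn ℝ (Ioi 0) fun y : ℝ => β * y :=
    ((LinearMap.mul ℝ ℝ) β).convexOn (convex_Ioi 0)
  refine (hlin.add (convexOn_logStdMixture (aemeasurable_tilt β hg) hf
    (lintegral_tilt_ne_zero β hg hpos) h4)).congr fun y hy => ?_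
  rw [log_stdMixture_eq β hg hpos (stdMixture_lt_top 0 hf hy)]
  rfl

end LogMixture

/-! ### Transport along the affine change of variable, and the theorem -/

section Affine

variable {F f : ℝ → ℝ≥0∞} {c : ℝ≥0∞} {μ σ : ℝ}

lemma IsModeOn.comp_affine (hσ : 0 < σ) (hf : ∀ y, f y = c * F ((y - μ) / σ)) {m : ℝ}
    (h : IsModeOn univ F m) : IsModeOn univ f (μ + σ * m) := by
  simp only [IsModeOn, univ_inter] at h ⊢
  constructor
  · intro y hy z hz hyz
    rw [hf, hf]
    gcongr
    refine h.1 ?_ ?_ (by gcongr)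
    · rw [mem_Iic, div_le_iff₀ hσ]; linarith [mem_Iic.1 hy]
    · rw [mem_Iic, div_le_iff₀ hσ]; linarith [mem_Iic.1 hz]
  · intro y hy z hz hyz
    rw [hf, hf]
    gcongr
    refine h.2 ?_ ?_ (by gcongr)
    · rw [mem_Ici, le_div_iff₀ hσ]; linarith [mem_Ici.1 hy]
    · rw [mem_Ici, le_div_iff₀ hσ]; linarith [mem_Ici.1 hz]

lemma IsLocalMax.of_comp_affine (hσ : 0 < σ) (hc0 : c ≠ 0) (hc : c ≠ ∞)
    (hf : ∀ y, f y = c * F ((y - μ) / σ)) {y : ℝ} (h : IsLocalMax f y) :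
    IsLocalMax F ((y - μ) / σ) := by
  have h1 : Tendsto (fun z => μ + σ * z) (𝓝 ((y - μ) / σ)) (𝓝 y) := by
    have hcont : Continuous fun z => μ + σ * z := by fun_prop
    have := hcont.tendsto ((y - μ) / σ)
    rwa [mul_div_cancel₀ _ hσ.ne', add_sub_cancel] at this
  filter_upwards [h1.eventually h] with z hz
  rw [hf, hf, ENNReal.mul_le_mul_iff_right hc0 hc, add_sub_cancel_left,
    mul_div_cancel_left₀ _ hσ.ne'] at hz
  exact hz

lemma log_toReal_comp_affine (hc0 : c ≠ 0) (hc : c ≠ ∞) (hf : ∀ y, f y = c * F ((y - μ) / σ))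
    {y : ℝ} (h0 : 0 < F ((y - μ) / σ)) (h1 : F ((y - μ) / σ) < ∞) :
    Real.log (f y).toReal = Real.log c.toReal + Real.log (F ((y - μ) / σ)).toReal := by
  rw [hf, ENNReal.toReal_mul, Real.log_mul (ENNReal.toReal_pos hc0 hc).ne'
    (ENNReal.toReal_pos h0.ne' h1.ne).ne']

lemma ConvexOn.comp_sub_div {φ : ℝ → ℝ} {I : Set ℝ} (h : ConvexOn ℝ I φ) (a b μ σ : ℝ) :
    ConvexOn ℝ ((fun y => b * ((y - μ) / σ)) ⁻¹' I) fun y => a + φ (b * ((y - μ) / σ)) := by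
  have e : ∀ x y s t : ℝ, s + t = 1 → b * ((s * x + t * y - μ) / σ)
      = s * (b * ((x - μ) / σ)) + t * (b * ((y - μ) / σ)) := by
    intro x y s t hst
    have : μ = s * μ + t * μ := by rw [← add_mul, hst, one_mul]
    linear_combination (-b / σ) * this
  refine ⟨fun x hx y hy s t hs ht hst => ?_, fun x hx y hy s t hs ht hst => ?_⟩
  · simp only [mem_preimage, smul_eq_mul, e x y s t hst]
    exact h.1 hx hy hs ht hst
  · have := h.2 hx hy hs ht hst
    simp only [smul_eq_mul, e x y s t hst] at this ⊢
    have h2 : a = s * a + t * a := by rw [← add_mul, hst, one_mul]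
    linarith

end Affine

theorem theorem1 {Ω : Type*} [MeasurableSpace Ω] (P : Measure Ω) [IsProbabilityMeasure P]
    (X Z : Ω → ℝ) (μ β σ : ℝ) (hσ : 0 < σ)
    (g : ℝ → ℝ≥0∞) (hg : AEMeasurable g volume) (hg_supp : ∀ x ≤ 0, g x = 0)
    (hX : HasLaw X (volume.withDensity g) P) (hZ : HasLaw Z (gaussianReal 0 1) P)
    (hXZ : IndepFun X Z P) :
    HasLaw (fun ω => μ + β * X ω + σ * Real.sqrt (X ω) * Z ω)
        (volume.withDensity (mixtureDensity μ β σ g)) P ∧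
      (∀ y, y ≠ μ → mixtureDensity μ β σ g y < ∞) ∧
      (UnimodalOn (Ioi 0) g → UnimodalOn univ (mixtureDensity μ β σ g)) ∧
      (AntitoneOn g (Ioi 0) ∨ β = 0 →
        IsModeOn univ (mixtureDensity μ β σ g) μ ∧
          ∀ y, IsLocalMax (mixtureDensity μ β σ g) y → y = μ) ∧
      (LogConcaveOn (Ioi 0) g → LogConcaveOn univ (mixtureDensity μ β σ g)) ∧
      (LogConvexOn (Ioi 0) g →
        LogConvexOn (Iio μ) (mixtureDensity μ β σ g) ∧
          LogConvexOn (Ioi μ) (mixtureDensity μ β σ g)) := by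
  have hone := lintegral_density_eq_one hg_supp hX
  have hfin : ∫⁻ x in Ioi (0 : ℝ), g x ≠ ∞ := by rw [hone]; exact ENNReal.one_ne_top
  have hpos : ∫⁻ x in Ioi (0 : ℝ), g x ≠ 0 := by rw [hone]; exact one_ne_zero
  set c := ENNReal.ofReal σ⁻¹ with hcdef
  have hc0 : c ≠ 0 := by simpa [hcdef] using hσ
  have hc : c ≠ ∞ := ENNReal.ofReal_ne_top
  have hf : ∀ y, mixtureDensity μ β σ g y = c * stdMixture (β / σ) g ((y - μ) / σ) :=
    mixtureDensity_eq_stdMixture μ β hσ g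
  have hF0 := stdMixture_pos (β / σ) hg hpos
  have hf0 : ∀ y, 0 < mixtureDensity μ β σ g y := fun y => by
    rw [hf]; exact ENNReal.mul_pos hc0 (hF0 _).ne'
  have hne : ∀ y, y ≠ μ → (y - μ) / σ ≠ 0 := fun y hy =>
    div_ne_zero (sub_ne_zero.2 hy) hσ.ne'
  have hflt : ∀ y, y ≠ μ → mixtureDensity μ β σ g y < ∞ := fun y hy => by
    rw [hf]
    exact ENNReal.mul_lt_top hc.lt_top (stdMixture_lt_top_of_ne _ hfin (hne y hy))
  refine ⟨hasLaw_mixture P X Z μ β σ hσ g hg hg_supp hX hZ hXZ, hflt, ?_, ?_, ?_, ?_⟩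
  · intro h
    obtain ⟨m, hm⟩ := stdMixture_unimodal (β := β / σ) hg hfin hpos h
    exact ⟨_, hm.comp_affine hσ hf⟩
  · intro h
    have h' : AntitoneOn g (Ioi 0) ∨ β / σ = 0 := h.imp_right fun hb => by simp [hb]
    refine ⟨by simpa using (stdMixture_isModeOn_zero hg hfin hpos h').comp_affine hσ hf,
      fun y hy => ?_⟩
    by_contra hyμ
    exact not_isLocalMax_stdMixture hg hfin hpos h' (hne y hyμ)
      (hy.of_comp_affine hσ hc0 hc hf)
  · intro h
    obtain ⟨hlt, hconc⟩ := stdMixture_lt_top_and_concaveOn_log (β / σ) hg hfin hpos h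
    refine logConcaveOn_of_concaveOn_log (fun y _ => ⟨hf0 y, ?_⟩) ?_
    · rw [hf]; exact ENNReal.mul_lt_top hc.lt_top (hlt _)
    · have h1 := (hconc.neg.comp_sub_div (-Real.log c.toReal) 1 μ σ).neg
      refine (h1.subset (subset_univ _) convex_univ).congr fun y _ => ?_
      rw [log_toReal_comp_affine hc0 hc hf (hF0 _) (hlt _)]
      simp only [Pi.neg_apply, one_mul]
      ring
  · intro h
    constructor
    · refine ⟨fun y hy => ⟨hf0 y, hflt y (ne_of_lt hy)⟩, ?_⟩
      -- Reflection at μ turns the left half-line into the right one and reverses the drift; hence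
      -- the factor -1.
      have h1 := (convexOn_log_stdMixture (-(β / σ)) hg hfin hpos h).comp_sub_div
        (Real.log c.toReal) (-1) μ σ
      refine (h1.subset (fun y (hy : y < μ) => ?_) (convex_Iio μ)).congr fun y hy => ?_
      · have : (y - μ) / σ < 0 := div_neg_of_neg_of_pos (by linarith) hσ
        simpa using this
      · rw [log_toReal_comp_affine hc0 hc hf (hF0 _)
          (stdMixture_lt_top_of_ne _ hfin (hne y (ne_of_lt hy)))]
        simp only [neg_one_mul, stdMixture_neg, neg_neg]
    · refine ⟨fun y hy => ⟨hf0 y, hflt y (ne_of_gt hy)⟩, ?_⟩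
      have h1 := (convexOn_log_stdMixture (β / σ) hg hfin hpos h).comp_sub_div
        (Real.log c.toReal) 1 μ σ
      refine (h1.subset (fun y (hy : μ < y) => ?_) (convex_Ioi μ)).congr fun y hy => ?_
      · have : 0 < (y - μ) / σ := div_pos (by linarith) hσ
        simpa using this
      · rw [log_toReal_comp_affine hc0 hc hf (hF0 _)
          (stdMixture_lt_top_of_ne _ hfin (hne y (ne_of_gt hy)))]
        simp only [one_mul]
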